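/- **Unique prime decomposition.** Let HOmp be the minimal higher-order process calculus with parameterization. Its terms are $$P,Q ::= 0 \mid X \mid m(X).P \mid \overline{m}(Q) \mid P\,|\,Q \mid \langle X\rangle P \mid P\langle Q\rangle \mid \langle x\rangle P \mid P\langle n\rangle ,$$ where $X$ ranges over process variables and $m,n$ over names (name constants and name variables $x$); $m(X).P$ and $\langle X\rangle P$ bind $X$, $\langle x\rangle P$ binds $x$, and terms are taken modulo $\alpha$-conversion and may be open. All terms are well typed: names are sorted, every sort $s$ having a fixed type $\mathrm{ob}(s)$ of the terms carried by channels of sort $s$; types are $T ::= \diamond \mid T\to\diamond \mid s\to\diamond$ (non-abstractions, process abstractions with parameter of type $T$, name abstractions with parameter of sort $s$); every process variable has a type, there are infinitely many variables of each type and infinitely many name constants and name variables of each sort; parallel composition, prefixing and abstraction apply only to bodies of type $\diamond$, and applications and outputs must respect types. A *process* is a term of type $\diamond$. Structural congruence $\equiv$ is the smallest congruence on terms satisfying $(P|Q)|R\equiv P|(Q|R)$, $P|Q\equiv Q|P$, $P|0\equiv P$, $(\langle X\rangle P)\langle Q\rangle\equiv P\{Q/X\}$ and $(\langle x\rangle P)\langle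 m\rangle\equiv P\{m/x\}$. Transitions are generated by $m(X).P\xrightarrow{m(X)}P$; $\overline m(Q)\xrightarrow{\overline m(Q)}0$; $P|Q\xrightarrow{\lambda}P'|Q$ if $P\xrightarrow{\lambda}P'$ and the variable bound by $\lambda$, if any, is not free in $Q$; $P|Q\xrightarrow{\tau}P'|Q'\{A/X\}$ if $P\xrightarrow{\overline m(A)}P'$ and $Q\xrightarrow{m(X)}Q'$; the symmetric rules; and closure under $\equiv$ on both sides. Strong bisimilarity $\sim$ is the largest strong HO-IO bisimulation, i.e. the largest symmetric relation $\mathcal R$ between terms of the same type such that $P\,\mathcal R\,Q$ implies: (1) if $P$ is not an abstraction, neither is $Q$; (2) if $P=\langle Y\rangle A$, then $Q=\langle Y\rangle B$ with $A\,\mathcal R\,B$; (3) if $P=\langle y\rangle A$, then $Q=\langle y\rangle B$ with $A\,\mathcal R\,B$; (4) if $P\xrightarrow{\overline m(A)}P'$, then $Q\xrightarrow{\overline m(B)}Q'$ with $A\,\mathcal R\,B$ and $P'\,\mathcal R\,Q'$; (5) if $P\xrightarrow{m(X)}P'$, then $Q\xrightarrow{m(X)}Q'$ with $P'\,\mathcal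 R\,Q'$; (6) if $P\equiv X|P'$, then $Q\equiv X|Q'$ with $P'\,\mathcal R\,Q'$ (and, for a variable $X$ of abstraction type, if $P\equiv X$ then $Q\equiv X$); (7) if $P\equiv X\langle A\rangle|P'$, then $Q\equiv X\langle B\rangle|Q'$ with $A\,\mathcal R\,B$ and $P'\,\mathcal R\,Q'$; (8) if $P\equiv X\langle n\rangle|P'$, then $Q\equiv X\langle n\rangle|Q'$ with $P'\,\mathcal R\,Q'$. A process $P$ is *prime* if $P\not\sim 0$ and, for all processes $P_1,P_2$, $P\sim P_1|P_2$ implies $P_1\sim 0$ or $P_2\sim 0$. A *prime decomposition* of $P$ is a product $\prod_{i=1}^n P_i=P_1|\cdots|P_n$ ($n\ge 0$, the empty product being $0$) of prime processes $P_i$ with $P\sim\prod_{i=1}^n P_i$. Then every process $P$ has a prime decomposition. Moreover, if $\prod_{i=1}^n P_i$ and $\prod_{j=1}^m Q_j$ are two prime decompositions of $P$, then $n=m$ and there is a permutation $\sigma$ of $\{1,\dots,n\}$ such that $P_i\sim Q_{\sigma(i)}$ for each $i\in\{1,\dots,n\}$. -/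

import Mathlib

universe u

namespace HOmp

/-- The types of terms over a set `S` of name sorts: `proc` is the type of non-abstractions,
`pabs T` the type of process abstractions whose parameter has type `T`, and `nabs s` the type of
name abstractions whose parameter is a name of sort `s`.  Types are finite trees, so all
abstractions have finite order. -/
inductive Ty (S : Type u) : Type u
  | proc : Ty S
  | pabs (T : Ty S) : Ty S
  | nabs (s : S) : Ty S

/-- Names of sort `s`: name constants and name variables (de Bruijn indices, one numbering for
each sort). -/
inductive Nm {S : Type u} (s : S) : Type
  | const (i : ℕ) : Nm s
  | var (i : ℕ) : Nm s

/-- Well-typed terms modulo `α`-conversion.  The sorting `ob` says that channels of sort `s` carry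
terms of type `ob s`.  For every type `T` there are infinitely many process variables
`var 0, var 1, …` of type `T`, and for every sort infinitely many name variables; they are de Bruijn
indices, numbered separately for each type and each sort, and a binder of type `T` (sort `s`)
affects the indices of type `T` (sort `s`) only.  Indices that exceed the number of enclosing
binders of their type are free variables, so terms may be open. -/
inductive Tm {S : Type u} (ob : S → Ty S) : Ty S → Type u
  /-- `0` -/
  | nil : Tm ob .proc
  /-- a process variable `X` of type `T` -/
  | var {T : Ty S} (i : ℕ) : Tm ob T
  /-- `m(X).P`, binding the variable `0` of type `ob s` in `P` -/
  | inp {s : S} (m : Nm s) (P : Tm ob .proc) : Tm ob .proc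
  /-- the output of `Q` on `m` -/
  | out {s : S} (m : Nm s) (Q : Tm ob (ob s)) : Tm ob .proc
  /-- `P | Q` -/
  | par (P Q : Tm ob .proc) : Tm ob .proc
  /-- `⟨X⟩P`, binding the variable `0` of type `T` in `P` -/
  | pabs {T : Ty S} (P : Tm ob .proc) : Tm ob (.pabs T)
  /-- `F⟨A⟩` -/
  | papp {T : Ty S} (F : Tm ob (.pabs T)) (A : Tm ob T) : Tm ob .proc
  /-- `⟨x⟩P`, binding the name variable `0` of sort `s` in `P` -/
  | nabs {s : S} (P : Tm ob .proc) : Tm ob (.nabs s)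
  /-- `F⟨n⟩` -/
  | napp {s : S} (F : Tm ob (.nabs s)) (n : Nm s) : Tm ob .proc

/-- Processes: the (possibly open) terms that are not abstractions. -/
abbrev Proc {S : Type u} (ob : S → Ty S) : Type u := Tm ob .proc

section Substitution

variable {S : Type u} {ob : S → Ty S}

/-- Renamings of indices, for an index set `K` of types or of sorts. -/
abbrev Ren (K : Type u) : Type u := K → ℕ → ℕ

/-- The identity renaming. -/
def Ren.id {K : Type u} : Ren K := fun _ i => i

open Classical in
/-- The renaming that makes room for a new variable `0` of kind `k`. -/
noncomputable def Ren.shift {K : Type u} (k : K) : Ren K :=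
  fun k' i => if k' = k then i + 1 else i

open Classical in
/-- Lifting of a renaming under a binder of kind `k`. -/
noncomputable def Ren.lift {K : Type u} (k : K) (r : Ren K) : Ren K := fun k' i =>
  if k' = k then
    match i with
    | 0 => 0
    | j + 1 => r k' j + 1
  else r k' i

/-- Replacement of the name variables in a name. -/
def Nm.subst {s : S} (w : ∀ s : S, ℕ → Nm s) : Nm s → Nm s
  | .const i => .const i
  | .var i => w s i

/-- Renaming of the name variable in a name. -/
def Nm.rename {s : S} (r : Ren S) : Nm s → Nm s
  | .const i => .const i
  | .var i => .var (r s i)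

/-- Simultaneous renaming of process variables (by `p`) and of name variables (by `r`). -/
noncomputable def Tm.rename : {T : Ty S} → Ren (Ty S) → Ren S → Tm ob T → Tm ob T
  | _, _, _, .nil => .nil
  | T, p, _, .var i => .var (p T i)
  | _, p, r, .inp (s := s) m P => .inp (m.rename r) (P.rename (p.lift (ob s)) r)
  | _, p, r, .out m Q => .out (m.rename r) (Q.rename p r)
  | _, p, r, .par P Q => .par (P.rename p r) (Q.rename p r)
  | _, p, r, .pabs (T := T) P => .pabs (P.rename (p.lift T) r)
  | _, p, r, .papp F A => .papp (F.rename p r) (A.rename p r)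
  | _, p, r, .nabs (s := s) P => .nabs (P.rename p (r.lift s))
  | _, p, r, .napp F n => .napp (F.rename p r) (n.rename r)

/-- Weakening by a new process variable `0` of type `T`. -/
noncomputable def Tm.weaken (T : Ty S) {U : Ty S} (P : Tm ob U) : Tm ob U :=
  P.rename (Ren.shift T) Ren.id

/-- Weakening by a new name variable `0` of sort `s`. -/
noncomputable def Tm.nweaken (s : S) {U : Ty S} (P : Tm ob U) : Tm ob U :=
  P.rename Ren.id (Ren.shift s)

open Classical in
/-- Lifting of a substitution for process variables under a binder of type `T`. -/
noncomputable def liftSub (T : Ty S) (v : ∀ U : Ty S, ℕ → Tm ob U) : ∀ U : Ty S, ℕ → Tm ob U :=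
  fun U i =>
    if U = T then
      match i with
      | 0 => .var 0
      | j + 1 => (v U j).weaken T
    else (v U i).weaken T

open Classical in
/-- Lifting of a substitution for name variables under a binder of sort `s`. -/
noncomputable def liftNSub (s : S) (w : ∀ t : S, ℕ → Nm t) : ∀ t : S, ℕ → Nm t :=
  fun t i =>
    if t = s then
      match i with
      | 0 => .var 0
      | j + 1 => (w t j).rename (Ren.shift s)
    else (w t i).rename (Ren.shift s)

/-- Simultaneous capture-avoiding substitution of terms for process variables (by `v`) and of names
for name variables (by `w`). -/
noncomputable def Tm.subst :
    {T : Ty S} → (∀ U : Ty S, ℕ → Tm ob U) → (∀ t : S, ℕ → Nm t) → Tm ob T → Tm ob T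
  | _, _, _, .nil => .nil
  | T, v, _, .var i => v T i
  | _, v, w, .inp (s := s) m P => .inp (m.subst w) (P.subst (liftSub (ob s) v) w)
  | _, v, w, .out m Q => .out (m.subst w) (Q.subst v w)
  | _, v, w, .par P Q => .par (P.subst v w) (Q.subst v w)
  | _, v, w, .pabs (T := T) P => .pabs (P.subst (liftSub T v) w)
  | _, v, w, .papp F A => .papp (F.subst v w) (A.subst v w)
  | _, v, w, .nabs (s := s) P =>
      .nabs (P.subst (fun U i => (v U i).nweaken s) (liftNSub s w))
  | _, v, w, .napp F n => .napp (F.subst v w) (n.subst w)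

open Classical in
/-- `P{A/X}`, where `X` is the variable `0` of type `T`, which disappears. -/
noncomputable def Tm.inst {T U : Ty S} (P : Tm ob U) (A : Tm ob T) : Tm ob U :=
  P.subst
    (fun V i =>
      if h : V = T then
        match i with
        | 0 => h ▸ A
        | j + 1 => .var j
      else .var i)
    (fun _ i => .var i)

open Classical in
/-- `P{n/x}`, where `x` is the name variable `0` of sort `s`, which disappears. -/
noncomputable def Tm.ninst {s : S} {U : Ty S} (P : Tm ob U) (n : Nm s) : Tm ob U :=
  P.subst (fun _ i => .var i)
    (fun t i =>
      if h : t = s then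
        match i with
        | 0 => h ▸ n
        | j + 1 => .var j
      else .var i)

end Substitution

section Semantics

variable {S : Type u} {ob : S → Ty S}

/-- Structural congruence: the smallest congruence on terms that contains the commutative monoid
laws of parallel composition and the two laws of application. -/
inductive SC : {T : Ty S} → Tm ob T → Tm ob T → Prop
  | refl {T : Ty S} (P : Tm ob T) : SC P P
  | symm {T : Ty S} {P Q : Tm ob T} : SC P Q → SC Q P
  | trans {T : Ty S} {P Q R : Tm ob T} : SC P Q → SC Q R → SC P R
  | inp {s : S} (m : Nm s) {P Q : Proc ob} : SC P Q → SC (.inp m P) (.inp m Q)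
  | out {s : S} (m : Nm s) {A B : Tm ob (ob s)} : SC A B → SC (.out m A) (.out m B)
  | par {P P' Q Q' : Proc ob} : SC P P' → SC Q Q' → SC (.par P Q) (.par P' Q')
  | pabs {T : Ty S} {P Q : Proc ob} : SC P Q → SC (.pabs (T := T) P) (.pabs Q)
  | papp {T : Ty S} {F G : Tm ob (.pabs T)} {A B : Tm ob T} :
      SC F G → SC A B → SC (.papp F A) (.papp G B)
  | nabs {s : S} {P Q : Proc ob} : SC P Q → SC (.nabs (s := s) P) (.nabs Q)
  | napp {s : S} {F G : Tm ob (.nabs s)} (n : Nm s) : SC F G → SC (.napp F n) (.napp G n)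
  | par_assoc (P Q R : Proc ob) : SC (.par (.par P Q) R) (.par P (.par Q R))
  | par_comm (P Q : Proc ob) : SC (.par P Q) (.par Q P)
  | par_nil (P : Proc ob) : SC (.par P .nil) P
  | papp_pabs {T : Ty S} (P : Proc ob) (A : Tm ob T) : SC (.papp (.pabs P) A) (P.inst A)
  | napp_nabs {s : S} (P : Proc ob) (n : Nm s) : SC (.napp (.nabs P) n) (P.ninst n)

/-- Actions.  The bound variable of an input action on a channel of sort `s` is the variable `0` of
type `ob s` of the target of the transition. -/
inductive Act (ob : S → Ty S) : Type u
  | inp {s : S} (m : Nm s) : Act ob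
  | out {s : S} (m : Nm s) (A : Tm ob (ob s)) : Act ob
  | tau : Act ob

/-- What a parallel component that does not take part in an action becomes: the same term, in which
the variable bound by an input action does not occur. -/
noncomputable def Act.frame : Act ob → Proc ob → Proc ob
  | .inp (s := s) _, Q => Q.weaken (ob s)
  | .out _ _, Q => Q
  | .tau, Q => Q

/-- The labelled transition system on open terms (with late instantiation of inputs). -/
inductive Step : Act ob → Proc ob → Proc ob → Prop
  | inp {s : S} (m : Nm s) (P : Proc ob) : Step (.inp m) (.inp m P) P
  | out {s : S} (m : Nm s) (A : Tm ob (ob s)) : Step (.out m A) (.out m A) .nil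
  | parL {a : Act ob} {P P' : Proc ob} (Q : Proc ob) :
      Step a P P' → Step a (.par P Q) (.par P' (a.frame Q))
  | parR {a : Act ob} {Q Q' : Proc ob} (P : Proc ob) :
      Step a Q Q' → Step a (.par P Q) (.par (a.frame P) Q')
  | comL {s : S} {m : Nm s} {A : Tm ob (ob s)} {P P' Q Q' : Proc ob} :
      Step (.out m A) P P' → Step (.inp m) Q Q' → Step .tau (.par P Q) (.par P' (Q'.inst A))
  | comR {s : S} {m : Nm s} {A : Tm ob (ob s)} {P P' Q Q' : Proc ob} :
      Step (.inp m) P P' → Step (.out m A) Q Q' → Step .tau (.par P Q) (.par (P'.inst A) Q')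
  | struct {a : Act ob} {P P' Q Q' : Proc ob} :
      SC Q P → Step a P P' → SC P' Q' → Step a Q Q'

/-- The term is syntactically an abstraction. -/
def Tm.IsAbs : {T : Ty S} → Tm ob T → Prop
  | _, .pabs _ => True
  | _, .nabs _ => True
  | _, _ => False

/-- Strong HO-IO bisimulations.  Bisimilar terms have the same type, so only relations between terms
of the same type are considered.  The clause for a free variable `X` at top level reads
`P ≡ X | P'` when `X` is a non-abstraction.  A variable of abstraction type cannot be composed in
parallel and stands alone (`P ≡ X`); this is `var_abs`. -/
structure IsHOIOBisimulation (R : ∀ ⦃T : Ty S⦄, Tm ob T → Tm ob T → Prop) : Prop where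
  symm : ∀ ⦃T : Ty S⦄ ⦃P Q : Tm ob T⦄, R P Q → R Q P
  non_abs : ∀ ⦃T : Ty S⦄ ⦃P Q : Tm ob T⦄, R P Q → ¬ P.IsAbs → ¬ Q.IsAbs
  pabs : ∀ ⦃T : Ty S⦄ ⦃A : Proc ob⦄ ⦃Q : Tm ob (.pabs T)⦄, R (.pabs A) Q →
    ∃ B : Proc ob, Q = .pabs B ∧ R A B
  nabs : ∀ ⦃s : S⦄ ⦃A : Proc ob⦄ ⦃Q : Tm ob (.nabs s)⦄, R (.nabs A) Q →
    ∃ B : Proc ob, Q = .nabs B ∧ R A B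
  out : ∀ ⦃P Q : Proc ob⦄, R P Q → ∀ ⦃s : S⦄ (m : Nm s) (A : Tm ob (ob s)) (P' : Proc ob),
    Step (.out m A) P P' →
      ∃ (B : Tm ob (ob s)) (Q' : Proc ob), Step (.out m B) Q Q' ∧ R A B ∧ R P' Q'
  inp : ∀ ⦃P Q : Proc ob⦄, R P Q → ∀ ⦃s : S⦄ (m : Nm s) (P' : Proc ob),
    Step (.inp m) P P' → ∃ Q' : Proc ob, Step (.inp m) Q Q' ∧ R P' Q'
  var : ∀ ⦃P Q : Proc ob⦄, R P Q → ∀ (i : ℕ) (P' : Proc ob),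
    SC P (.par (.var i) P') → ∃ Q' : Proc ob, SC Q (.par (.var i) Q') ∧ R P' Q'
  var_abs : ∀ ⦃T : Ty S⦄, T ≠ .proc → ∀ ⦃P Q : Tm ob T⦄, R P Q → ∀ i : ℕ,
    SC P (.var i) → SC Q (.var i)
  papp : ∀ ⦃P Q : Proc ob⦄, R P Q → ∀ ⦃T : Ty S⦄ (i : ℕ) (A : Tm ob T) (P' : Proc ob),
    SC P (.par (.papp (.var i) A) P') →
      ∃ (B : Tm ob T) (Q' : Proc ob), SC Q (.par (.papp (.var i) B) Q') ∧ R A B ∧ R P' Q'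
  napp : ∀ ⦃P Q : Proc ob⦄, R P Q → ∀ ⦃s : S⦄ (i : ℕ) (n : Nm s) (P' : Proc ob),
    SC P (.par (.napp (.var i) n) P') →
      ∃ Q' : Proc ob, SC Q (.par (.napp (.var i) n) Q') ∧ R P' Q'

/-- Strong (HO-IO) bisimilarity: the union of all strong HO-IO bisimulations. -/
def Bisim {T : Ty S} (P Q : Tm ob T) : Prop :=
  ∃ R : ∀ ⦃U : Ty S⦄, Tm ob U → Tm ob U → Prop, IsHOIOBisimulation R ∧ R P Q

/-- `P₁ | P₂ | ⋯ | Pₖ`; the empty product is `0`. -/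
def parList : List (Proc ob) → Proc ob
  | [] => .nil
  | [P] => P
  | P :: Q :: L => .par P (parList (Q :: L))

/-- Prime processes. -/
def IsPrime (P : Proc ob) : Prop :=
  ¬ Bisim P .nil ∧
    ∀ P₁ P₂ : Proc ob, Bisim P (.par P₁ P₂) → Bisim P₁ .nil ∨ Bisim P₂ .nil

/-- The product of the family `Ps` is a prime decomposition of `P`. -/
def IsPrimeDecomposition (P : Proc ob) {n : ℕ} (Ps : Fin n → Proc ob) : Prop :=
  (∀ i, IsPrime (Ps i)) ∧ Bisim P (parList (List.ofFn Ps))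

end Semantics

end HOmp

-- Modulo bisimilarity, processes form a commutative monoid under parallel composition, and primes
-- are exactly its indecomposable elements. The theorem therefore says that this monoid has unique
-- factorization, and the proof separates the process calculus from an argument about monoids with
-- transitions.
--
-- Structural congruence contains β-conversion, so it must first be made tractable. Evaluating terms
-- in a model that reads every process as a finite multiset of components (inputs, outputs,
-- variables, applied variables) gives `Tm.sc_iff_nf_eq`: congruence is equality of multisets. Since
-- parallel composition becomes multiset union, a component of `P | Q` belongs to `P` or to `Q`
-- (`SC.par_split`). All observations of a process are then instances of one operation, the removal
-- of a component, and bisimilarity is shown to be an equivalence compatible with renaming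
-- (`Bisim.rename`) and parallel composition (`Bisim.par`). A second model counts the symbols of the
-- β-normal form. This size is additive, drops with every observation, vanishes only at `0`, and is
-- a bisimulation invariant (`Bisim.size_eq`).
--
-- The monoid argument is by induction on weight. Decompositions exist because nontrivial summands
-- are lighter. For uniqueness, suppose two decompositions `s` and `t` of one element differ, and
-- let `c` be a heaviest element on whose multiplicity they disagree, with `s` containing it more
-- often. A move of another factor of `s` is answered in `t`, and by induction the residuals
-- decompose equally. Counting copies of `c` shows that the answering factor leaves strictly more
-- copies of `c` in its residual. That factor outweighs `c`, so it also lies in `s`, and the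
-- procedure repeats; the number of copies would grow without bound, although it is bounded by the
-- weight. If `s` consists of copies of `c` only, counting after one move shows that `c` itself
-- would be decomposable (`DecompositionSystem.UniqueBelow.not_count_lt`).
--
-- Late input makes the passive components be weakened by the new variable. The maps `frame` account
-- for this: they are injective, and they preserve weight and indecomposability.

namespace HOmp

-- Environments indexed by kind and de Bruijn index

section Cons

variable {J : Type u} {K L : J → Type*}

open Classical in
/-- Extension of a family of environments by a new value at index `0` of kind `k`. -/
noncomputable def cons (k : J) (a : K k) (v : ∀ j, ℕ → K j) : ∀ j, ℕ → K j := fun j i =>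
  if h : j = k then
    match i with
    | 0 => h ▸ a
    | n + 1 => v j n
  else v j i

@[simp] theorem cons_zero (k : J) (a : K k) (v : ∀ j, ℕ → K j) : cons k a v k 0 = a := by
  simp [cons]

@[simp] theorem cons_succ (k : J) (a : K k) (v : ∀ j, ℕ → K j) (n : ℕ) :
    cons k a v k (n + 1) = v k n := by
  simp [cons]

theorem cons_of_ne {k j : J} (h : j ≠ k) (a : K k) (v : ∀ j, ℕ → K j) (i : ℕ) :
    cons k a v j i = v j i := by
  simp [cons, h]

theorem cons_cases {k : J} {p : J → ℕ → Prop} (h0 : p k 0) (hs : ∀ n, p k (n + 1))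
    (hne : ∀ j i, j ≠ k → p j i) (j : J) (i : ℕ) : p j i := by
  by_cases h : j = k
  · subst h
    cases i with
    | zero => exact h0
    | succ n => exact hs n
  · exact hne j i h

theorem map_cons (f : ∀ j, K j → L j) (k : J) (a : K k) (v : ∀ j, ℕ → K j) :
    (fun j i => f j (cons k a v j i)) = cons k (f k a) (fun j i => f j (v j i)) := by
  funext j i
  refine cons_cases (k := k) (p := fun j i => f j (cons k a v j i) = _) ?_ ?_ ?_ j i
  · simp
  · simp
  · intro j i h
    simp [cons_of_ne h]

theorem cons_shift (k : J) (a : K k) (v : ∀ j, ℕ → K j) (j : J) (i : ℕ) :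
    cons k a v j (Ren.shift k j i) = v j i := by
  by_cases h : j = k
  · subst h
    simp [Ren.shift]
  · simp [Ren.shift, h, cons_of_ne h]

theorem cons_lift (k : J) (a : K k) (v : ∀ j, ℕ → K j) (r : Ren J) :
    (fun j i => cons k a v j (r.lift k j i)) = cons k a (fun j i => v j (r j i)) := by
  funext j i
  by_cases h : j = k
  · subst h
    cases i <;> simp [Ren.lift]
  · simp [Ren.lift, h, cons_of_ne h]

theorem cons_self_shift (k : J) (v : ∀ j, ℕ → K j) :
    cons k (v k 0) (fun j i => v j (Ren.shift k j i)) = v := by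
  funext j i
  refine cons_cases (k := k) (p := fun j i => cons k (v k 0) _ j i = v j i) ?_ ?_ ?_ j i
  · simp
  · simp [Ren.shift]
  · intro j i h
    simp [cons_of_ne h, Ren.shift, h]

theorem lift_eq_cons (k : J) (r : Ren J) :
    r.lift k = cons (K := fun _ => ℕ) k 0 (fun j i => Ren.shift k j (r j i)) := by
  funext j i
  by_cases h : j = k
  · subst h
    cases i <;> simp [Ren.lift, Ren.shift]
  · simp [Ren.lift, h, cons_of_ne h, Ren.shift]

theorem lift_shift (k : J) (r : Ren J) (j : J) (i : ℕ) :
    r.lift k j (Ren.shift k j i) = Ren.shift k j (r j i) := by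
  rw [lift_eq_cons, cons_shift (K := fun _ => ℕ)]

theorem lift_comp (k : J) (r r' : Ren J) :
    (fun j i => r'.lift k j (r.lift k j i)) = Ren.lift k (fun j i => r' j (r j i)) := by
  rw [lift_eq_cons k r', cons_lift (K := fun _ => ℕ), lift_eq_cons]

theorem lift_id (k : J) : Ren.lift k Ren.id = Ren.id := by
  rw [lift_eq_cons]
  exact cons_self_shift (K := fun _ => ℕ) k Ren.id

end Cons

-- The calculus of renaming and substitution

section Substitution

variable {S : Type u} {ob : S → Ty S}

/-- In this form every commutation under a binder reduces to `map_cons`, `cons_shift` and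
`cons_lift`. -/
theorem liftSub_eq_cons (T : Ty S) (v : ∀ U : Ty S, ℕ → Tm ob U) :
    liftSub T v = cons T (.var 0) (fun U i => (v U i).weaken T) := by
  funext U i
  by_cases h : U = T
  · subst h
    cases i <;> simp [liftSub]
  · simp [liftSub, h, cons_of_ne h]

theorem liftNSub_eq_cons (s : S) (w : ∀ t : S, ℕ → Nm t) :
    liftNSub s w = cons s (.var 0) (fun t i => (w t i).rename (Ren.shift s)) := by
  funext t i
  by_cases h : t = s
  · subst h
    cases i <;> simp [liftNSub]
  · simp [liftNSub, h, cons_of_ne h]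

theorem Tm.inst_eq {T U : Ty S} (P : Tm ob U) (A : Tm ob T) :
    P.inst A = P.subst (cons T A fun _ i => .var i) (fun _ i => .var i) := by
  rfl

theorem Tm.ninst_eq {s : S} {U : Ty S} (P : Tm ob U) (n : Nm s) :
    P.ninst n = P.subst (fun _ i => .var i) (cons s n fun _ i => .var i) := by
  rfl

theorem Nm.rename_rename {s : S} (r r' : Ren S) (m : Nm s) :
    (m.rename r).rename r' = m.rename (fun s i => r' s (r s i)) := by
  cases m <;> rfl

theorem Nm.rename_eq_subst {s : S} (r : Ren S) (m : Nm s) :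
    m.rename r = m.subst (fun s i => .var (r s i)) := by
  cases m <;> rfl

theorem Nm.subst_rename {s : S} (r : Ren S) (w : ∀ t : S, ℕ → Nm t) (m : Nm s) :
    (m.rename r).subst w = m.subst (fun s i => w s (r s i)) := by
  cases m <;> rfl

theorem Nm.subst_subst {s : S} (w w' : ∀ t : S, ℕ → Nm t) (m : Nm s) :
    (m.subst w).subst w' = m.subst (fun s i => (w s i).subst w') := by
  cases m <;> rfl

theorem Nm.rename_subst {s : S} (r : Ren S) (w : ∀ t : S, ℕ → Nm t) (m : Nm s) :
    (m.subst w).rename r = m.subst (fun s i => (w s i).rename r) := by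
  cases m <;> rfl

theorem Nm.subst_id {s : S} (m : Nm s) : m.subst (fun _ i => .var i) = m := by
  cases m <;> rfl

theorem liftSub_var (T : Ty S) (p : Ren (Ty S)) :
    liftSub T (fun U i => (.var (p U i) : Tm ob U)) = fun U i => .var (p.lift T U i) := by
  rw [liftSub_eq_cons, lift_eq_cons, map_cons (K := fun _ => ℕ) (fun U i => (.var i : Tm ob U))]
  rfl

theorem liftNSub_var (s : S) (r : Ren S) :
    liftNSub s (fun t i => (.var (r t i) : Nm t)) = fun t i => .var (r.lift s t i) := by
  rw [liftNSub_eq_cons, lift_eq_cons, map_cons (K := fun _ => ℕ) (fun t i => (.var i : Nm t))]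
  rfl

theorem Tm.rename_eq_subst {T : Ty S} (P : Tm ob T) (p : Ren (Ty S)) (r : Ren S) :
    P.rename p r = P.subst (fun U i => .var (p U i)) (fun t i => .var (r t i)) := by
  induction P generalizing p r with
  | nil => rfl
  | var i => rfl
  | inp m P ih => simp only [rename, subst, ih, Nm.rename_eq_subst, liftSub_var]
  | out m Q ih => simp only [rename, subst, ih, Nm.rename_eq_subst]
  | par P Q ihP ihQ => simp only [rename, subst, ihP, ihQ]
  | pabs P ih => simp only [rename, subst, ih, liftSub_var]
  | papp F A ihF ihA => simp only [rename, subst, ihF, ihA]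
  | nabs P ih => simp only [rename, subst, ih, liftNSub_var, nweaken, Ren.id]
  | napp F n ih => simp only [rename, subst, ih, Nm.rename_eq_subst]

theorem Tm.rename_rename {T : Ty S} (P : Tm ob T) (p p' : Ren (Ty S)) (r r' : Ren S) :
    (P.rename p r).rename p' r' =
      P.rename (fun U i => p' U (p U i)) (fun t i => r' t (r t i)) := by
  induction P generalizing p p' r r' with
  | nil => rfl
  | var i => rfl
  | inp m P ih => simp only [rename, ih, Nm.rename_rename, lift_comp]
  | out m Q ih => simp only [rename, ih, Nm.rename_rename]
  | par P Q ihP ihQ => simp only [rename, ihP, ihQ]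
  | pabs P ih => simp only [rename, ih, lift_comp]
  | papp F A ihF ihA => simp only [rename, ihF, ihA]
  | nabs P ih => simp only [rename, ih, lift_comp]
  | napp F n ih => simp only [rename, ih, Nm.rename_rename]

theorem liftSub_lift (T : Ty S) (p : Ren (Ty S)) (v : ∀ U : Ty S, ℕ → Tm ob U) :
    (fun U i => liftSub T v U (p.lift T U i)) = liftSub T (fun U i => v U (p U i)) := by
  simp only [liftSub_eq_cons, cons_lift]

theorem liftNSub_lift (s : S) (r : Ren S) (w : ∀ t : S, ℕ → Nm t) :
    (fun t i => liftNSub s w t (r.lift s t i)) = liftNSub s (fun t i => w t (r t i)) := by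
  simp only [liftNSub_eq_cons, cons_lift]

theorem Tm.subst_rename {T : Ty S} (P : Tm ob T) (p : Ren (Ty S)) (r : Ren S)
    (v : ∀ U : Ty S, ℕ → Tm ob U) (w : ∀ t : S, ℕ → Nm t) :
    (P.rename p r).subst v w = P.subst (fun U i => v U (p U i)) (fun t i => w t (r t i)) := by
  induction P generalizing p r v w with
  | nil => rfl
  | var i => rfl
  | inp m P ih => simp only [rename, subst, ih, Nm.subst_rename, liftSub_lift]
  | out m Q ih => simp only [rename, subst, ih, Nm.subst_rename]
  | par P Q ihP ihQ => simp only [rename, subst, ihP, ihQ]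
  | pabs P ih => simp only [rename, subst, ih, liftSub_lift]
  | papp F A ihF ihA => simp only [rename, subst, ihF, ihA]
  | nabs P ih => simp only [rename, subst, ih, liftNSub_lift]
  | napp F n ih => simp only [rename, subst, ih, Nm.subst_rename]

theorem Tm.rename_weaken {T U : Ty S} (P : Tm ob U) (p : Ren (Ty S)) (r : Ren S) :
    (P.weaken T).rename (p.lift T) r = (P.rename p r).weaken T := by
  simp only [weaken, rename_rename, lift_shift, Ren.id]

theorem Tm.rename_nweaken {s : S} {U : Ty S} (P : Tm ob U) (p : Ren (Ty S)) (r : Ren S) :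
    (P.nweaken s).rename p (r.lift s) = (P.rename p r).nweaken s := by
  simp only [nweaken, rename_rename, lift_shift, Ren.id]

theorem lift_zero {J : Type u} (k : J) (r : Ren J) : r.lift k k 0 = 0 := by
  simp [Ren.lift]

theorem rename_liftSub (T : Ty S) (p : Ren (Ty S)) (r : Ren S) (v : ∀ U : Ty S, ℕ → Tm ob U) :
    (fun U i => (liftSub T v U i).rename (p.lift T) r) =
      liftSub T (fun U i => (v U i).rename p r) := by
  simp only [liftSub_eq_cons]
  rw [map_cons (fun U (P : Tm ob U) => P.rename (p.lift T) r)]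
  simp only [Tm.rename_weaken, Tm.rename, lift_zero]

theorem rename_liftNSub (s : S) (r : Ren S) (w : ∀ t : S, ℕ → Nm t) :
    (fun t i => (liftNSub s w t i).rename (r.lift s)) =
      liftNSub s (fun t i => (w t i).rename r) := by
  simp only [liftNSub_eq_cons]
  rw [map_cons (fun t (m : Nm t) => m.rename (r.lift s))]
  simp only [Nm.rename_rename, lift_shift]
  simp only [Nm.rename, lift_zero]

theorem Tm.rename_subst {T : Ty S} (P : Tm ob T) (p : Ren (Ty S)) (r : Ren S)
    (v : ∀ U : Ty S, ℕ → Tm ob U) (w : ∀ t : S, ℕ → Nm t) :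
    (P.subst v w).rename p r =
      P.subst (fun U i => (v U i).rename p r) (fun t i => (w t i).rename r) := by
  induction P generalizing p r v w with
  | nil => rfl
  | var i => rfl
  | inp m P ih => simp only [rename, subst, ih, Nm.rename_subst, rename_liftSub]
  | out m Q ih => simp only [rename, subst, ih, Nm.rename_subst]
  | par P Q ihP ihQ => simp only [rename, subst, ihP, ihQ]
  | pabs P ih => simp only [rename, subst, ih, rename_liftSub]
  | papp F A ihF ihA => simp only [rename, subst, ihF, ihA]
  | nabs P ih => simp only [rename, subst, ih, rename_liftNSub, rename_nweaken]
  | napp F n ih => simp only [rename, subst, ih, Nm.rename_subst]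

theorem Tm.subst_weaken_cons {T U : Ty S} (P : Tm ob U) (A : Tm ob T)
    (v : ∀ U : Ty S, ℕ → Tm ob U) (w : ∀ t : S, ℕ → Nm t) :
    (P.weaken T).subst (cons T A v) w = P.subst v w := by
  simp only [weaken, subst_rename, cons_shift, Ren.id]

theorem Tm.subst_nweaken_cons {s : S} {U : Ty S} (P : Tm ob U) (n : Nm s)
    (v : ∀ U : Ty S, ℕ → Tm ob U) (w : ∀ t : S, ℕ → Nm t) :
    (P.nweaken s).subst v (cons s n w) = P.subst v w := by
  simp only [nweaken, subst_rename, cons_shift, Ren.id]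

theorem Tm.weaken_subst {T U : Ty S} (P : Tm ob U)
    (v : ∀ U : Ty S, ℕ → Tm ob U) (w : ∀ t : S, ℕ → Nm t) :
    (P.weaken T).subst (liftSub T v) w = (P.subst v w).weaken T := by
  rw [liftSub_eq_cons, subst_weaken_cons, weaken, rename_subst]
  congr 1
  funext t i
  cases w t i <;> rfl

theorem Tm.nweaken_subst {s : S} {U : Ty S} (P : Tm ob U)
    (v : ∀ U : Ty S, ℕ → Tm ob U) (w : ∀ t : S, ℕ → Nm t) :
    (P.nweaken s).subst (fun U i => (v U i).nweaken s) (liftNSub s w) =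
      (P.subst v w).nweaken s := by
  rw [liftNSub_eq_cons, subst_nweaken_cons, nweaken, rename_subst]
  rfl

theorem subst_liftSub (T : Ty S) (v v' : ∀ U : Ty S, ℕ → Tm ob U) (w' : ∀ t : S, ℕ → Nm t) :
    (fun U i => (liftSub T v U i).subst (liftSub T v') w') =
      liftSub T (fun U i => (v U i).subst v' w') := by
  rw [liftSub_eq_cons T v, liftSub_eq_cons T (fun U i => (v U i).subst v' w'),
    map_cons (fun U (P : Tm ob U) => P.subst (liftSub T v') w')]
  simp only [Tm.weaken_subst]
  simp [Tm.subst, liftSub_eq_cons]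

theorem subst_liftNSub (s : S) (w w' : ∀ t : S, ℕ → Nm t) :
    (fun t i => (liftNSub s w t i).subst (liftNSub s w')) =
      liftNSub s (fun t i => (w t i).subst w') := by
  simp only [liftNSub_eq_cons]
  rw [map_cons (fun t (m : Nm t) => m.subst _)]
  simp only [Nm.subst_rename, cons_shift, Nm.rename_subst]
  simp [Nm.subst]

/-- The mixed laws with renamings come earlier because lifting a substitution under a binder weakens
its values, and weakening is a renaming. -/
theorem Tm.subst_subst {T : Ty S} (P : Tm ob T) (v v' : ∀ U : Ty S, ℕ → Tm ob U)
    (w w' : ∀ t : S, ℕ → Nm t) :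
    (P.subst v w).subst v' w' =
      P.subst (fun U i => (v U i).subst v' w') (fun t i => (w t i).subst w') := by
  induction P generalizing v v' w w' with
  | nil => rfl
  | var i => rfl
  | inp m P ih => simp only [subst, ih, Nm.subst_subst, subst_liftSub]
  | out m Q ih => simp only [subst, ih, Nm.subst_subst]
  | par P Q ihP ihQ => simp only [subst, ihP, ihQ]
  | pabs P ih => simp only [subst, ih, subst_liftSub]
  | papp F A ihF ihA => simp only [subst, ihF, ihA]
  | nabs P ih => simp only [subst, ih, subst_liftNSub, nweaken_subst]
  | napp F n ih => simp only [subst, ih, Nm.subst_subst]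

theorem Tm.rename_id {T : Ty S} (P : Tm ob T) : P.rename Ren.id Ren.id = P := by
  have hN : ∀ {s : S} (m : Nm s), m.rename Ren.id = m := by
    intro s m
    cases m <;> rfl
  induction P with
  | nil => rfl
  | var i => rfl
  | inp m P ih => simp only [rename, lift_id, ih, hN]
  | out m Q ih => simp only [rename, ih, hN]
  | par P Q ihP ihQ => simp only [rename, ihP, ihQ]
  | pabs P ih => simp only [rename, lift_id, ih]
  | papp F A ihF ihA => simp only [rename, ihF, ihA]
  | nabs P ih => simp only [rename, lift_id, ih]
  | napp F n ih => simp only [rename, ih, hN]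

theorem Tm.subst_id {T : Ty S} (P : Tm ob T) :
    P.subst (fun _ i => .var i) (fun _ i => .var i) = P :=
  (P.rename_eq_subst Ren.id Ren.id).symm.trans P.rename_id

/-- The weakened values of `v` never mention the variable being instantiated, so both substitutions
merge into one with an extended environment. Together with `Tm.subst_inst` this makes the β law
stable under substitution. -/
theorem Tm.inst_subst_liftSub {T U : Ty S} (P : Tm ob U) (A : Tm ob T)
    (v : ∀ U : Ty S, ℕ → Tm ob U) (w : ∀ t : S, ℕ → Nm t) :
    (P.subst (liftSub T v) w).inst A = P.subst (cons T A v) w := by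
  rw [inst_eq, subst_subst, liftSub_eq_cons,
    map_cons (fun U (P : Tm ob U) => P.subst (cons T A fun _ i => .var i) (fun _ i => .var i))]
  simp only [subst_weaken_cons, subst_id, Nm.subst_id, subst, cons_zero]

theorem Tm.subst_inst {T U : Ty S} (P : Tm ob U) (A : Tm ob T)
    (v : ∀ U : Ty S, ℕ → Tm ob U) (w : ∀ t : S, ℕ → Nm t) :
    (P.inst A).subst v w = P.subst (cons T (A.subst v w) v) w := by
  rw [inst_eq, subst_subst, map_cons (fun U (P : Tm ob U) => P.subst v w)]
  rfl

theorem Tm.ninst_subst_liftNSub {s : S} {U : Ty S} (P : Tm ob U) (n : Nm s)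
    (v : ∀ U : Ty S, ℕ → Tm ob U) (w : ∀ t : S, ℕ → Nm t) :
    (P.subst (fun U i => (v U i).nweaken s) (liftNSub s w)).ninst n = P.subst v (cons s n w) := by
  rw [ninst_eq, subst_subst, liftNSub_eq_cons,
    map_cons (fun t (m : Nm t) => m.subst (cons s n fun _ i => .var i))]
  simp only [subst_nweaken_cons, subst_id, Nm.subst_rename, cons_shift, Nm.subst_id]
  simp only [Nm.subst, cons_zero]

theorem Tm.subst_ninst {s : S} {U : Ty S} (P : Tm ob U) (n : Nm s)
    (v : ∀ U : Ty S, ℕ → Tm ob U) (w : ∀ t : S, ℕ → Nm t) :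
    (P.ninst n).subst v w = P.subst v (cons s (n.subst w) w) := by
  rw [ninst_eq, subst_subst, map_cons (fun t (m : Nm t) => m.subst w)]
  rfl

theorem SC.subst {T : Ty S} {P Q : Tm ob T} (h : SC P Q) (v : ∀ U : Ty S, ℕ → Tm ob U)
    (w : ∀ t : S, ℕ → Nm t) : SC (P.subst v w) (Q.subst v w) := by
  induction h generalizing v w with
  | refl P => exact .refl _
  | symm _ ih => exact .symm (ih v w)
  | trans _ _ ih₁ ih₂ => exact .trans (ih₁ v w) (ih₂ v w)
  | inp m _ ih => exact .inp _ (ih _ _)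
  | out m _ ih => exact .out _ (ih _ _)
  | par _ _ ih₁ ih₂ => exact .par (ih₁ _ _) (ih₂ _ _)
  | pabs _ ih => exact .pabs (ih _ _)
  | papp _ _ ih₁ ih₂ => exact .papp (ih₁ _ _) (ih₂ _ _)
  | nabs _ ih => exact .nabs (ih _ _)
  | napp n _ ih => exact .napp _ (ih _ _)
  | par_assoc P Q R => exact .par_assoc _ _ _
  | par_comm P Q => exact .par_comm _ _
  | par_nil P => exact .par_nil _
  | papp_pabs P A =>
    rw [Tm.subst_inst, ← Tm.inst_subst_liftSub]
    exact .papp_pabs _ _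
  | napp_nabs P n =>
    rw [Tm.subst_ninst, ← Tm.ninst_subst_liftNSub]
    exact .napp_nabs _ _

theorem SC.rename {T : Ty S} {P Q : Tm ob T} (h : SC P Q) (p : Ren (Ty S)) (r : Ren S) :
    SC (P.rename p r) (Q.rename p r) := by
  simp only [Tm.rename_eq_subst]
  exact h.subst _ _

theorem SC.liftSub {v v' : ∀ U : Ty S, ℕ → Tm ob U} (h : ∀ U i, SC (v U i) (v' U i)) (T U : Ty S)
    (i : ℕ) : SC (HOmp.liftSub T v U i) (HOmp.liftSub T v' U i) := by
  simp only [liftSub_eq_cons]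
  refine cons_cases (k := T) (p := fun U i => SC (cons T _ _ U i) (cons T _ _ U i)) ?_ ?_ ?_ U i
  · simpa using .refl _
  · intro n
    simpa [Tm.weaken] using (h T n).rename _ _
  · intro U i hne
    simpa [cons_of_ne hne, Tm.weaken] using (h U i).rename _ _

theorem SC.subst_congr {T : Ty S} (P : Tm ob T) {v v' : ∀ U : Ty S, ℕ → Tm ob U}
    (h : ∀ U i, SC (v U i) (v' U i)) (w : ∀ t : S, ℕ → Nm t) :
    SC (P.subst v w) (P.subst v' w) := by
  induction P generalizing v v' w with
  | nil => exact .refl _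
  | var i => exact h _ i
  | inp m P ih => exact .inp _ (ih (SC.liftSub h _) _)
  | out m Q ih => exact .out _ (ih h _)
  | par P Q ihP ihQ => exact .par (ihP h _) (ihQ h _)
  | pabs P ih => exact .pabs (ih (SC.liftSub h _) _)
  | papp F A ihF ihA => exact .papp (ihF h _) (ihA h _)
  | nabs P ih => exact .nabs (ih (fun U i => (h U i).rename _ _) _)
  | napp F n ih => exact .napp _ (ih h _)

end Substitution

-- Normal forms by evaluation, and structural congruence as equality of multisets

section NormalForms

variable {S : Type u} {ob : S → Ty S}

/-- Structural congruence as a setoid. -/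
def scSetoid (ob : S → Ty S) (T : Ty S) : Setoid (Tm ob T) where
  r := SC
  iseqv := ⟨.refl, .symm, .trans⟩

/-- Terms modulo structural congruence. -/
def TmQ (ob : S → Ty S) (T : Ty S) : Type u := Quotient (scSetoid ob T)

/-- The class of a term modulo structural congruence. -/
def Tm.mk {T : Ty S} (P : Tm ob T) : TmQ ob T := Quotient.mk _ P

/-- A representative of a class of terms. -/
noncomputable def TmQ.out {T : Ty S} (a : TmQ ob T) : Tm ob T := Quotient.out a

@[simp] theorem TmQ.mk_out {T : Ty S} (a : TmQ ob T) : a.out.mk = a := Quotient.out_eq a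

theorem Tm.mk_eq_mk {T : Ty S} {P Q : Tm ob T} : P.mk = Q.mk ↔ SC P Q :=
  ⟨fun h => Quotient.exact h, fun h => Quotient.sound h⟩

theorem Tm.out_mk {T : Ty S} (P : Tm ob T) : SC P.mk.out P := Tm.mk_eq_mk.1 (TmQ.mk_out _)

noncomputable instance : Add (TmQ ob .proc) := ⟨fun a b => (Tm.par a.out b.out).mk⟩

instance : Zero (TmQ ob .proc) := ⟨Tm.nil.mk⟩

noncomputable instance : AddCommMonoid (TmQ ob .proc) where
  add_assoc a b c := Tm.mk_eq_mk.2 <|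
    (SC.par (Tm.out_mk _) (.refl _)).trans <| (SC.par_assoc _ _ _).trans <|
      SC.par (.refl _) (Tm.out_mk _).symm
  zero_add a := by
    conv_rhs => rw [← a.mk_out]
    exact Tm.mk_eq_mk.2 <| (SC.par_comm _ _).trans <|
      (SC.par (.refl _) (Tm.out_mk _)).trans (SC.par_nil _)
  add_zero a := by
    conv_rhs => rw [← a.mk_out]
    exact Tm.mk_eq_mk.2 <| (SC.par (.refl _) (Tm.out_mk _)).trans (SC.par_nil _)
  add_comm a b := Tm.mk_eq_mk.2 (SC.par_comm _ _)
  nsmul := nsmulRec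

theorem Tm.mk_par (P Q : Proc ob) : (Tm.par P Q).mk = P.mk + Q.mk :=
  Tm.mk_eq_mk.2 (SC.par (Tm.out_mk _).symm (Tm.out_mk _).symm)

/-- The components of a process in normal form, with subterms from the family `K`. -/
inductive Hd (ob : S → Ty S) (K : Ty S → Type u) : Type u
  | inp {s : S} (m : Nm s) (P : K .proc) : Hd ob K
  | out {s : S} (m : Nm s) (A : K (ob s)) : Hd ob K
  | var (i : ℕ) : Hd ob K
  | papp {T : Ty S} (i : ℕ) (A : K T) : Hd ob K
  | napp {s : S} (i : ℕ) (n : Nm s) : Hd ob K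

/-- The action of a map between families of subterms. -/
def Hd.map {K L : Ty S → Type u} (f : ∀ {T : Ty S}, K T → L T) : Hd ob K → Hd ob L
  | .inp m P => .inp m (f P)
  | .out m A => .out m (f A)
  | .var i => .var i
  | .papp i A => .papp i (f A)
  | .napp (s := s) i n => .napp (s := s) i n

/-- The process that consists of a single component. -/
def Hd.toTm : Hd ob (Tm ob) → Proc ob
  | .inp m P => .inp m P
  | .out m A => .out m A
  | .var i => .var i
  | .papp i A => .papp (.var i) A
  | .napp i n => .napp (.var i) n

/-- Components modulo structural congruence of their subterms. -/
abbrev HdQ (ob : S → Ty S) : Type u := Hd ob (TmQ ob)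

/-- The class of a component. -/
def Hd.mk (h : Hd ob (Tm ob)) : HdQ ob := h.map Tm.mk

theorem Hd.exists_mk (h : HdQ ob) : ∃ h' : Hd ob (Tm ob), h'.mk = h :=
  ⟨h.map TmQ.out, by cases h <;> simp [Hd.map, Hd.mk]⟩

/-- The process class of a component class. -/
noncomputable def Hd.toTmQ (h : HdQ ob) : TmQ ob .proc := (h.map TmQ.out).toTm.mk

theorem Hd.toTmQ_mk (h : Hd ob (Tm ob)) : h.mk.toTmQ = h.toTm.mk := by
  refine Tm.mk_eq_mk.2 ?_
  cases h with
  | inp m P => exact .inp m (Tm.out_mk P)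
  | out m A => exact .out m (Tm.out_mk A)
  | var i => exact .refl _
  | papp i A => exact .papp (.refl _) (Tm.out_mk A)
  | napp i n => exact .refl _

/-- The product of the components of a normal form. -/
noncomputable def readback (μ : Multiset (HdQ ob)) : TmQ ob .proc := (μ.map Hd.toTmQ).sum

/-- The model in which processes denote normal forms. -/
def Sem (ob : S → Ty S) : Ty S → Type u
  | .proc => Multiset (HdQ ob)
  | .pabs T => TmQ ob T → Sem ob T → Multiset (HdQ ob)
  | .nabs s => Nm s → Multiset (HdQ ob)

instance : AddCommMonoid (Sem ob .proc) := inferInstanceAs (AddCommMonoid (Multiset (HdQ ob)))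

/-- The interpretation of terms: `v` and `w` are the syntactic values of the variables, `e` the
semantic values of the process variables. -/
noncomputable def Tm.eval : {T : Ty S} → Tm ob T → (∀ U : Ty S, ℕ → TmQ ob U) →
    (∀ t : S, ℕ → Nm t) → (∀ U : Ty S, ℕ → Sem ob U) → Sem ob T
  | _, .nil, _, _, _ => 0
  | T, .var i, _, _, e => e T i
  -- Evaluation stops at prefixes: the body is kept as a class modulo `SC`. This is why syntactic
  -- values accompany the semantic ones.
  | _, .inp (s := s) m P, v, w, _ =>
      ({.inp (m.subst w) (P.subst (liftSub (ob s) fun U i => (v U i).out) w).mk} :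
        Multiset (HdQ ob))
  | _, .out m A, v, w, _ =>
      ({.out (m.subst w) (A.subst (fun U i => (v U i).out) w).mk} : Multiset (HdQ ob))
  | _, .par P Q, v, w, e => P.eval v w e + Q.eval v w e
  | _, .pabs (T := T) P, v, w, e => fun B b => P.eval (cons T B v) w (cons T b e)
  | _, .papp F A, v, w, e => F.eval v w e (A.subst (fun U i => (v U i).out) w).mk (A.eval v w e)
  | _, .nabs (s := s) P, v, w, e => fun n => P.eval v (cons s n w) e
  | _, .napp F n, v, w, e => F.eval v w e (n.subst w)

theorem Tm.eval_rename {T : Ty S} (P : Tm ob T) (p : Ren (Ty S)) (r : Ren S)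
    (v : ∀ U : Ty S, ℕ → TmQ ob U) (w : ∀ t : S, ℕ → Nm t) (e : ∀ U : Ty S, ℕ → Sem ob U) :
    (P.rename p r).eval v w e =
      P.eval (fun U i => v U (p U i)) (fun t i => w t (r t i)) (fun U i => e U (p U i)) := by
  induction P generalizing p r v w e with
  | nil => rfl
  | var i => rfl
  | inp m P ih =>
    simp only [rename, eval, subst_rename, Nm.subst_rename, liftSub_lift]
    rfl
  | out m Q ih =>
    simp only [rename, eval, subst_rename, Nm.subst_rename]
    rfl
  | par P Q ihP ihQ => simp only [rename, eval, ihP, ihQ]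
  | pabs P ih =>
    simp only [rename, eval, ih, cons_lift]
    rfl
  | papp F A ihF ihA =>
    simp only [rename, eval, ihF, ihA, subst_rename]
    rfl
  | nabs P ih =>
    simp only [rename, eval, ih, cons_lift]
    rfl
  | napp F n ih =>
    simp only [rename, eval, ih, Nm.subst_rename]
    rfl

theorem Tm.mk_subst_out {T : Ty S} (P : Tm ob T) (v : ∀ U : Ty S, ℕ → Tm ob U)
    (w : ∀ t : S, ℕ → Nm t) :
    (P.subst (fun U i => (v U i).mk.out) w).mk = (P.subst v w).mk :=
  Tm.mk_eq_mk.2 (SC.subst_congr P (fun U i => Tm.out_mk (v U i)) w)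

theorem Tm.mk_subst_liftSub_out {T U : Ty S} (P : Tm ob T) (v : ∀ U : Ty S, ℕ → Tm ob U)
    (w : ∀ t : S, ℕ → Nm t) :
    (P.subst (liftSub U fun U i => (v U i).mk.out) w).mk = (P.subst (liftSub U v) w).mk :=
  Tm.mk_eq_mk.2 (SC.subst_congr P (SC.liftSub (fun U i => Tm.out_mk (v U i)) U) w)

theorem Tm.mk_subst_cons {T U : Ty S} (P : Tm ob U) (B : TmQ ob T) (v : ∀ U : Ty S, ℕ → TmQ ob U)
    (w : ∀ t : S, ℕ → Nm t) :
    P.subst (fun U i => (cons T B v U i).out) w =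
      P.subst (cons T B.out fun U i => (v U i).out) w := by
  rw [map_cons (fun U (a : TmQ ob U) => a.out)]

/-- Substituting first amounts to evaluating in a changed environment; this validates both
application laws in the model. -/
theorem Tm.eval_subst {T : Ty S} (P : Tm ob T) (v' : ∀ U : Ty S, ℕ → Tm ob U)
    (w' : ∀ t : S, ℕ → Nm t) (v : ∀ U : Ty S, ℕ → TmQ ob U) (w : ∀ t : S, ℕ → Nm t)
    (e : ∀ U : Ty S, ℕ → Sem ob U) :
    (P.subst v' w').eval v w e =
      P.eval (fun U i => ((v' U i).subst (fun U i => (v U i).out) w).mk)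
        (fun t i => (w' t i).subst w) (fun U i => (v' U i).eval v w e) := by
  induction P generalizing v' w' v w e with
  | nil => rfl
  | var i => rfl
  | inp m P ih =>
    simp only [subst, eval, mk_subst_liftSub_out, subst_subst, subst_liftSub, Nm.subst_subst]
    rfl
  | out m Q ih =>
    simp only [subst, eval, mk_subst_out, subst_subst, Nm.subst_subst]
    rfl
  | par P Q ihP ihQ => simp only [subst, eval, ihP, ihQ]
  | @pabs T P ih =>
    simp only [subst, eval, ih]
    funext B b
    have h1 : (fun U i => ((liftSub T v' U i).subst (fun U i => (cons T B v U i).out) w).mk) =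
        cons T B fun U i => ((v' U i).subst (fun U i => (v U i).out) w).mk := by
      rw [liftSub_eq_cons, map_cons fun U (Q : Tm ob U) =>
        (Q.subst (fun U i => (cons T B v U i).out) w).mk]
      simp only [mk_subst_cons, subst_weaken_cons]
      simp [subst]
    have h2 : (fun U i => (liftSub T v' U i).eval (cons T B v) w (cons T b e)) =
        cons T b fun U i => (v' U i).eval v w e := by
      rw [liftSub_eq_cons, map_cons fun U (Q : Tm ob U) => Q.eval (cons T B v) w (cons T b e)]
      simp only [weaken, eval_rename, cons_shift, Ren.id]
      simp [eval]
    rw [h1, h2]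
  | papp F A ihF ihA =>
    simp only [subst, eval, ihF, ihA, mk_subst_out, subst_subst]
    rfl
  | @nabs s P ih =>
    simp only [subst, eval, ih]
    funext n
    have h1 : (fun t i => (liftNSub s w' t i).subst (cons s n w)) =
        cons s n fun t i => (w' t i).subst w := by
      rw [liftNSub_eq_cons, map_cons fun t (m : Nm t) => m.subst (cons s n w)]
      simp only [Nm.subst_rename, cons_shift]
      simp [Nm.subst]
    simp only [h1, subst_nweaken_cons]
    simp only [nweaken, eval_rename, cons_shift, Ren.id]
  | napp F n ih =>
    simp only [subst, eval, ih, Nm.subst_subst]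
    rfl

/-- Soundness of the model. The monoid laws hold for multisets and the application laws by
`Tm.eval_subst`; terms stored below prefixes or passed as syntactic arguments agree by `SC.subst`.
-/
theorem SC.eval_eq {T : Ty S} {P Q : Tm ob T} (h : SC P Q) (v : ∀ U : Ty S, ℕ → TmQ ob U)
    (w : ∀ t : S, ℕ → Nm t) (e : ∀ U : Ty S, ℕ → Sem ob U) : P.eval v w e = Q.eval v w e := by
  induction h generalizing v w e with
  | refl P => rfl
  | symm _ ih => exact (ih v w e).symm
  | trans _ _ ih₁ ih₂ => exact (ih₁ v w e).trans (ih₂ v w e)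
  | inp m h ih =>
    simp only [Tm.eval, Tm.mk_eq_mk.2 (h.subst _ _)]
    rfl
  | out m h ih =>
    simp only [Tm.eval, Tm.mk_eq_mk.2 (h.subst _ _)]
    rfl
  | par _ _ ih₁ ih₂ => simp only [Tm.eval, ih₁, ih₂]
  | pabs _ ih =>
    simp only [Tm.eval, ih]
    rfl
  | papp _ h ih₁ ih₂ =>
    simp only [Tm.eval, ih₁, ih₂, Tm.mk_eq_mk.2 (h.subst _ _)]
    rfl
  | nabs _ ih =>
    simp only [Tm.eval, ih]
    rfl
  | napp n _ ih =>
    simp only [Tm.eval, ih]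
    rfl
  | par_assoc P Q R => exact add_assoc (G := Sem _ .proc) _ _ _
  | par_comm P Q => exact add_comm (G := Sem _ .proc) _ _
  | par_nil P => exact add_zero (M := Sem _ .proc) _
  | @papp_pabs T P A =>
    rw [Tm.inst_eq, Tm.eval_subst,
      map_cons fun U (Q : Tm _ U) => (Q.subst (fun U i => (v U i).out) w).mk,
      map_cons fun U (Q : Tm _ U) => Q.eval v w e]
    simp only [Tm.eval, Tm.subst, TmQ.mk_out, Nm.subst]
  | napp_nabs P n =>
    rw [Tm.ninst_eq, Tm.eval_subst, map_cons fun t (m : Nm t) => m.subst w]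
    simp only [Tm.eval, Tm.subst, TmQ.mk_out, Nm.subst]

/-- A term class is related to the normal form that it denotes. -/
def Reads : {T : Ty S} → TmQ ob T → Sem ob T → Prop
  | .proc, a, μ => a = readback μ
  | .pabs _, F, f => ∀ A a, Reads A a → (Tm.papp F.out A.out).mk = readback (f A a)
  | .nabs _, F, f => ∀ n, (Tm.napp F.out n).mk = readback (f n)

/-- The denotation of a free variable. -/
def reflect : (T : Ty S) → ℕ → Sem ob T
  | .proc, i => ({.var i} : Multiset (HdQ ob))
  | .pabs _, i => fun A _ => {.papp i A}
  | .nabs _, i => fun n => {.napp i n}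

theorem readback_add (μ ν : Multiset (HdQ ob)) : readback (μ + ν) = readback μ + readback ν := by
  simp [readback]

theorem readback_singleton (h : HdQ ob) : readback {h} = h.toTmQ := by
  simp [readback]

theorem reads_var (T : Ty S) (i : ℕ) : Reads (Tm.var i : Tm ob T).mk (reflect T i) := by
  cases T with
  | proc => exact (readback_singleton (.var i)).symm
  | pabs T =>
    intro A a _
    refine Eq.trans ?_ (readback_singleton (.papp i A)).symm
    exact Tm.mk_eq_mk.2 (.papp (Tm.out_mk _) (.refl _))
  | nabs s =>
    intro n
    refine Eq.trans ?_ (readback_singleton (.napp i n)).symm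
    exact Tm.mk_eq_mk.2 (.napp _ (Tm.out_mk _))

/-- The fundamental lemma of the logical relation `Reads`. Because the relation at
process-abstraction types quantifies over related arguments, the application case is immediate, and
the abstraction case is one β step. -/
theorem Tm.reads_eval {T : Ty S} (P : Tm ob T) {v : ∀ U : Ty S, ℕ → TmQ ob U}
    (w : ∀ t : S, ℕ → Nm t) {e : ∀ U : Ty S, ℕ → Sem ob U} (h : ∀ U i, Reads (v U i) (e U i)) :
    Reads (P.subst (fun U i => (v U i).out) w).mk (P.eval v w e) := by
  induction P generalizing v w e with
  | nil => rfl
  | var i => simpa [subst, eval] using h _ i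
  | inp m P ih =>
    refine Eq.trans ?_ (readback_singleton _).symm
    exact (Hd.toTmQ_mk (.inp _ _)).symm
  | out m Q ih =>
    refine Eq.trans ?_ (readback_singleton _).symm
    exact (Hd.toTmQ_mk (.out _ _)).symm
  | par P Q ihP ihQ =>
    refine Eq.trans (Tm.mk_par _ _) (Eq.trans ?_ (readback_add _ _).symm)
    exact congrArg₂ (· + ·) (ihP w h) (ihQ w h)
  | @pabs T P ih =>
    intro A a hA
    have hcons : ∀ U i, Reads (cons T A v U i) (cons T a e U i) := by
      refine cons_cases (k := T) ?_ ?_ ?_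
      · simpa using hA
      · simpa using h T
      · intro U i hne
        simpa [cons_of_ne hne] using h U i
    refine Eq.trans ?_ (ih w hcons)
    rw [mk_subst_cons, ← inst_subst_liftSub]
    exact Tm.mk_eq_mk.2 ((SC.papp (Tm.out_mk _) (.refl _)).trans (.papp_pabs _ _))
  | papp F A ihF ihA =>
    refine Eq.trans ?_ (ihF w h _ _ (ihA w h))
    exact Tm.mk_eq_mk.2 (.papp (Tm.out_mk _).symm (Tm.out_mk _).symm)
  | @nabs s P ih =>
    intro n
    refine Eq.trans ?_ (ih (cons s n w) h)
    rw [← ninst_subst_liftNSub]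
    exact Tm.mk_eq_mk.2 ((SC.napp _ (Tm.out_mk _)).trans (.napp_nabs _ _))
  | napp F n ih =>
    refine Eq.trans ?_ (ih w h _)
    exact Tm.mk_eq_mk.2 (.napp _ (Tm.out_mk _).symm)

/-- The normal form of a process. -/
noncomputable def Tm.nf (P : Proc ob) : Multiset (HdQ ob) :=
  P.eval (fun _ i => (Tm.var i).mk) (fun _ i => .var i) reflect

theorem SC.nf_eq {P Q : Proc ob} (h : SC P Q) : P.nf = Q.nf := h.eval_eq _ _ _

theorem Tm.mk_eq_readback_nf (P : Proc ob) : P.mk = readback P.nf := by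
  have h := P.reads_eval (fun _ i => .var i) (reads_var (ob := ob))
  refine Eq.trans ?_ h
  rw [mk_subst_out, subst_id]

/-- Soundness gives one direction; conversely a process can be recovered from its normal form by
`readback`. -/
theorem Tm.sc_iff_nf_eq {P Q : Proc ob} : SC P Q ↔ P.nf = Q.nf :=
  ⟨SC.nf_eq, fun h => mk_eq_mk.1 (by rw [mk_eq_readback_nf, h, ← mk_eq_readback_nf])⟩

theorem Tm.nf_nil : (Tm.nil : Proc ob).nf = 0 := rfl

theorem Tm.nf_par (P Q : Proc ob) : (Tm.par P Q).nf = P.nf + Q.nf := rfl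

theorem Hd.nf_toTm (h : Hd ob (Tm ob)) : h.toTm.nf = {h.mk} := by
  have hN : ∀ {s : S} (n : Nm s), n.subst (fun _ i => .var i) = n := Nm.subst_id
  have hT : ∀ {T : Ty S} (A : Tm ob T),
      (A.subst (fun _ i => (Tm.var i).mk.out) (fun _ i => .var i)).mk = A.mk := by
    intro T A
    rw [Tm.mk_subst_out, Tm.subst_id]
  cases h with
  | @inp s m P =>
    have h1 : liftSub (ob s) (fun _ i => .var i) = fun U i => (.var i : Tm ob U) :=
      (liftSub_var (ob s) Ren.id).trans (by rw [lift_id]; rfl)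
    simp only [toTm, Tm.nf, Tm.eval, hN, Tm.mk_subst_liftSub_out, h1, Tm.subst_id]
    rfl
  | out m A =>
    simp only [toTm, Tm.nf, Tm.eval, hN, hT]
    rfl
  | var i => rfl
  | papp i A =>
    simp only [toTm, Tm.nf, Tm.eval, hT]
    rfl
  | napp i n =>
    simp only [toTm, Tm.nf, Tm.eval, hN]
    rfl

theorem Tm.exists_nf_eq (μ : Multiset (HdQ ob)) : ∃ P : Proc ob, P.nf = μ := by
  induction μ using Multiset.induction_on with
  | empty => exact ⟨.nil, nf_nil⟩
  | cons h μ ih =>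
    obtain ⟨P, rfl⟩ := ih
    obtain ⟨h', rfl⟩ := h.exists_mk
    exact ⟨.par h'.toTm P, by rw [nf_par, h'.nf_toTm, Multiset.singleton_add]⟩

theorem sc_par_iff {P R : Proc ob} {h : Hd ob (Tm ob)} :
    SC P (.par h.toTm R) ↔ P.nf = h.mk ::ₘ R.nf := by
  rw [Tm.sc_iff_nf_eq, Tm.nf_par, h.nf_toTm, Multiset.singleton_add]

theorem exists_sc_par_of_mem {P : Proc ob} {h : Hd ob (Tm ob)} (hh : h.mk ∈ P.nf) :
    ∃ R, SC P (.par h.toTm R) := by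
  obtain ⟨μ, hμ⟩ := Multiset.exists_cons_of_mem hh
  obtain ⟨R, rfl⟩ := Tm.exists_nf_eq μ
  exact ⟨R, sc_par_iff.2 hμ⟩

/-- In a multiset union a given element lies in one of the summands, and cancelling it identifies
the remainder. -/
theorem SC.par_split {P Q R : Proc ob} {h : Hd ob (Tm ob)} (hs : SC (.par P Q) (.par h.toTm R)) :
    (∃ P', SC P (.par h.toTm P') ∧ SC R (.par P' Q)) ∨
      (∃ Q', SC Q (.par h.toTm Q') ∧ SC R (.par P Q')) := by
  rw [sc_par_iff, Tm.nf_par] at hs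
  have hmem : h.mk ∈ P.nf + Q.nf := hs ▸ Multiset.mem_cons_self _ _
  rcases Multiset.mem_add.1 hmem with hm | hm
  · obtain ⟨P', hP'⟩ := exists_sc_par_of_mem hm
    refine .inl ⟨P', hP', ?_⟩
    rw [sc_par_iff.1 hP', Multiset.cons_add, Multiset.cons_inj_right] at hs
    rw [Tm.sc_iff_nf_eq, Tm.nf_par, hs]
  · obtain ⟨Q', hQ'⟩ := exists_sc_par_of_mem hm
    refine .inr ⟨Q', hQ', ?_⟩
    rw [sc_par_iff.1 hQ', Multiset.add_cons, Multiset.cons_inj_right] at hs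
    rw [Tm.sc_iff_nf_eq, Tm.nf_par, hs]

theorem not_sc_nil_par {R : Proc ob} {h : Hd ob (Tm ob)} : ¬ SC .nil (.par h.toTm R) := by
  rw [sc_par_iff, Tm.nf_nil]
  exact (Multiset.cons_ne_zero).symm

theorem sc_nil_or_exists_hd (P : Proc ob) :
    SC P .nil ∨ ∃ (h : Hd ob (Tm ob)) (R : Proc ob), SC P (.par h.toTm R) := by
  by_cases h0 : P.nf = 0
  · exact .inl (Tm.sc_iff_nf_eq.2 h0)
  · obtain ⟨h, hh⟩ := Multiset.exists_mem_of_ne_zero h0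
    obtain ⟨h', rfl⟩ := h.exists_mk
    exact .inr ⟨h', exists_sc_par_of_mem hh⟩

/-- Renaming of the variables of a component. -/
noncomputable def Hd.rename (p : Ren (Ty S)) (r : Ren S) : Hd ob (Tm ob) → Hd ob (Tm ob)
  | .inp (s := s) m P => .inp (m.rename r) (P.rename (p.lift (ob s)) r)
  | .out m A => .out (m.rename r) (A.rename p r)
  | .var i => .var (p .proc i)
  | .papp (T := T) i A => .papp (p (.pabs T) i) (A.rename p r)
  | .napp (s := s) i n => .napp (p (.nabs s) i) (n.rename r)

theorem Hd.rename_toTm (p : Ren (Ty S)) (r : Ren S) (h : Hd ob (Tm ob)) :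
    h.toTm.rename p r = (h.rename p r).toTm := by
  cases h <;> rfl

/-- Renaming acts on a normal form component by component, so it can neither create nor merge
components, even when it is not injective. The induction is on the number of components of `P`. -/
theorem SC.rename_split {p : Ren (Ty S)} {r : Ren S} {P R : Proc ob} {h : Hd ob (Tm ob)}
    (hs : SC (P.rename p r) (.par h.toTm R)) :
    ∃ (h' : Hd ob (Tm ob)) (P' : Proc ob), SC P (.par h'.toTm P') ∧ (h'.rename p r).mk = h.mk ∧
      SC R (P'.rename p r) := by
  induction hn : P.nf.card generalizing P R with
  | zero =>
    exfalso
    have h0 : SC P .nil := Tm.sc_iff_nf_eq.2 (Multiset.card_eq_zero.1 hn)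
    exact not_sc_nil_par ((h0.rename p r).symm.trans hs)
  | succ n ih =>
    obtain ⟨k, hk⟩ := Multiset.card_pos_iff_exists_mem.1 (by omega : 0 < P.nf.card)
    obtain ⟨k, rfl⟩ := k.exists_mk
    obtain ⟨Q, hQ⟩ := exists_sc_par_of_mem hk
    have hQ' := hQ.rename p r
    simp only [Tm.rename, Hd.rename_toTm] at hQ'
    -- Either the component peeled off `P` is the required one, or the required one comes from the
    -- remainder `Q`.
    rcases (hQ'.symm.trans hs).par_split with ⟨P', hP', hR⟩ | ⟨Q', hQ'', hR⟩
    · rw [sc_par_iff, Hd.nf_toTm] at hP'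
      have h1 : (k.rename p r).mk = h.mk := by
        have : h.mk ∈ ({(k.rename p r).mk} : Multiset (HdQ ob)) := by simp [hP']
        exact (Multiset.mem_singleton.1 this).symm
      refine ⟨k, Q, hQ, h1, hR.trans ?_⟩
      have h2 : P'.nf = 0 := by
        rw [← Multiset.card_eq_zero]
        simpa using congrArg Multiset.card hP'
      rw [Tm.sc_iff_nf_eq, Tm.nf_par, h2, zero_add]
    · have hc : Q.nf.card = n := by
        rw [sc_par_iff.1 hQ, Multiset.card_cons] at hn
        omega
      obtain ⟨h', P', hP', hh', hQP⟩ := ih hQ'' hc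
      refine ⟨h', .par k.toTm P', ?_, hh', ?_⟩
      · rw [sc_par_iff] at hQ hP' ⊢
        rw [hQ, hP', Tm.nf_par, k.nf_toTm, Multiset.singleton_add, Multiset.cons_swap]
      · refine hR.trans ?_
        simp only [Tm.rename, Hd.rename_toTm]
        exact .par (.refl _) hQP

/-- The shape of structurally congruent terms of abstraction type. -/
inductive AbsSC : {T : Ty S} → Tm ob T → Tm ob T → Prop
  | proc (P Q : Proc ob) : AbsSC P Q
  | pabs {T : Ty S} {P Q : Proc ob} : SC P Q → AbsSC (.pabs (T := T) P) (.pabs Q)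
  | nabs {s : S} {P Q : Proc ob} : SC P Q → AbsSC (.nabs (s := s) P) (.nabs Q)
  | var {T : Ty S} (i : ℕ) : AbsSC (.var i : Tm ob T) (.var i)

/-- There is no η law and no congruence law produces abstractions from other terms, so congruent
terms of abstraction type have the same outermost form. The bisimulation clauses for abstractions
need this because they demand syntactic equality. -/
theorem SC.absSC {T : Ty S} {P Q : Tm ob T} (h : SC P Q) : AbsSC P Q := by
  induction h with
  | @refl T P =>
    cases P with
    | pabs P => exact .pabs (.refl P)
    | nabs P => exact .nabs (.refl P)
    | var i => exact .var i
    | _ => exact .proc _ _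
  | symm _ ih =>
    cases ih with
    | proc P Q => exact .proc _ _
    | pabs h => exact .pabs h.symm
    | nabs h => exact .nabs h.symm
    | var i => exact .var i
  | trans _ _ ih₁ ih₂ =>
    cases ih₁ with
    | proc P Q => exact .proc _ _
    | pabs h => cases ih₂ with | pabs h' => exact .pabs (h.trans h')
    | nabs h => cases ih₂ with | nabs h' => exact .nabs (h.trans h')
    | var i => exact ih₂
  | pabs h _ => exact .pabs h
  | nabs h _ => exact .nabs h
  | _ => exact .proc _ _

theorem SC.pabs_left {T : Ty S} {A : Proc ob} {Q : Tm ob (.pabs T)} (h : SC (.pabs A) Q) :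
    ∃ B, Q = .pabs B ∧ SC A B := by
  cases h.absSC with
  | pabs h' => exact ⟨_, rfl, h'⟩

theorem SC.nabs_left {s : S} {A : Proc ob} {Q : Tm ob (.nabs s)} (h : SC (.nabs A) Q) :
    ∃ B, Q = .nabs B ∧ SC A B := by
  cases h.absSC with
  | nabs h' => exact ⟨_, rfl, h'⟩

theorem SC.var_left {T : Ty S} (hT : T ≠ .proc) {i : ℕ} {Q : Tm ob T} (h : SC (.var i) Q) :
    Q = .var i := by
  cases h.absSC with
  | proc => exact absurd rfl hT
  | var => rfl

theorem Tm.not_isAbs_iff {T : Ty S} {P : Tm ob T} : ¬ P.IsAbs ↔ T = .proc ∨ ∃ i, P = .var i := by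
  cases P <;> simp [Tm.IsAbs]

theorem SC.isAbs_iff {T : Ty S} {P Q : Tm ob T} (h : SC P Q) : P.IsAbs ↔ Q.IsAbs := by
  cases h.absSC with
  | proc P Q => cases P <;> cases Q <;> simp [Tm.IsAbs]
  | pabs => simp [Tm.IsAbs]
  | nabs => simp [Tm.IsAbs]
  | var => rfl

end NormalForms

-- The size of the β-normal form

section Size

variable {S : Type u} {ob : S → Ty S}

/-- The model in which processes denote the sizes of their normal forms. -/
def SizeSem : Ty S → Type
  | .proc => ℕ
  | .pabs T => SizeSem T → ℕ
  | .nabs _ => ℕ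

mutual

/-- The denotation of a free variable in the size model. -/
def sizeReflect : (T : Ty S) → SizeSem T
  | .proc => (1 : ℕ)
  -- An applied variable is a component of size one plus its argument.
  | .pabs T => fun a => (sizeReify T a + 1 : ℕ)
  | .nabs _ => (1 : ℕ)

/-- The size that corresponds to a denotation in the size model. -/
def sizeReify : (T : Ty S) → SizeSem T → ℕ
  | .proc, n => n
  -- An abstraction is measured by applying it to a free variable. The extra one makes its body
  -- strictly smaller, as the induction in `Bisim.size_eq` requires.
  | .pabs T, f => (f (sizeReflect T) : ℕ) + 1
  | .nabs _, n => Nat.succ n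

end

/-- The interpretation of terms in the size model. -/
noncomputable def Tm.sizeEval : {T : Ty S} → Tm ob T → (∀ U : Ty S, ℕ → SizeSem U) → SizeSem T
  | _, .nil, _ => (0 : ℕ)
  | T, .var i, e => e T i
  | _, .inp (s := s) _ P, e => (Nat.succ (P.sizeEval (cons (ob s) (sizeReflect _) e)) : ℕ)
  | _, .out _ A, e => (sizeReify _ (A.sizeEval e) + 1 : ℕ)
  | _, .par P Q, e => Nat.add (P.sizeEval e) (Q.sizeEval e)
  | _, .pabs (T := T) P, e => fun b => P.sizeEval (cons T b e)
  | _, .papp F A, e => F.sizeEval e (A.sizeEval e)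
  | _, .nabs P, e => P.sizeEval e
  | _, .napp F _, e => F.sizeEval e

theorem Tm.sizeEval_rename {T : Ty S} (P : Tm ob T) (p : Ren (Ty S)) (r : Ren S)
    (e : ∀ U : Ty S, ℕ → SizeSem U) :
    (P.rename p r).sizeEval e = P.sizeEval (fun U i => e U (p U i)) := by
  induction P generalizing p r e with
  | nil => rfl
  | var i => rfl
  | inp m P ih =>
    simp only [rename, sizeEval, ih, cons_lift]
    rfl
  | out m Q ih =>
    simp only [rename, sizeEval, ih]
    rfl
  | par P Q ihP ihQ =>
    simp only [rename, sizeEval, ihP, ihQ]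
    rfl
  | pabs P ih =>
    simp only [rename, sizeEval, ih, cons_lift]
    rfl
  | papp F A ihF ihA =>
    simp only [rename, sizeEval, ihF, ihA]
    rfl
  | nabs P ih => exact ih _ _ _
  | napp F n ih => exact ih _ _ _

theorem sizeEval_liftSub {T : Ty S} (v : ∀ U : Ty S, ℕ → Tm ob U) (b : SizeSem T)
    (e : ∀ U : Ty S, ℕ → SizeSem U) :
    (fun U i => (liftSub T v U i).sizeEval (cons T b e)) =
      cons T b fun U i => (v U i).sizeEval e := by
  rw [liftSub_eq_cons, map_cons fun U (Q : Tm ob U) => Q.sizeEval (cons T b e)]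
  simp only [Tm.weaken, Tm.sizeEval_rename, cons_shift]
  simp [Tm.sizeEval]

theorem Tm.sizeEval_subst {T : Ty S} (P : Tm ob T) (v : ∀ U : Ty S, ℕ → Tm ob U)
    (w : ∀ t : S, ℕ → Nm t) (e : ∀ U : Ty S, ℕ → SizeSem U) :
    (P.subst v w).sizeEval e = P.sizeEval (fun U i => (v U i).sizeEval e) := by
  induction P generalizing v w e with
  | nil => rfl
  | var i => rfl
  | inp m P ih =>
    simp only [subst, sizeEval, ih, sizeEval_liftSub]
    rfl
  | out m Q ih =>
    simp only [subst, sizeEval, ih]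
    rfl
  | par P Q ihP ihQ =>
    simp only [subst, sizeEval, ihP, ihQ]
    rfl
  | pabs P ih =>
    simp only [subst, sizeEval, ih, sizeEval_liftSub]
    rfl
  | papp F A ihF ihA =>
    simp only [subst, sizeEval, ihF, ihA]
    rfl
  | nabs P ih =>
    simp only [subst, sizeEval, ih, nweaken, sizeEval_rename]
    rfl
  | napp F n ih => exact ih _ _ _

/-- A direct symbol count would change under β; interpreting abstractions as functions of the
denotation of their argument makes it invariant. -/
theorem SC.sizeEval_eq {T : Ty S} {P Q : Tm ob T} (h : SC P Q) (e : ∀ U : Ty S, ℕ → SizeSem U) :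
    P.sizeEval e = Q.sizeEval e := by
  induction h generalizing e with
  | refl P => rfl
  | symm _ ih => exact (ih e).symm
  | trans _ _ ih₁ ih₂ => exact (ih₁ e).trans (ih₂ e)
  | inp m h ih =>
    simp only [Tm.sizeEval, ih]
    rfl
  | out m h ih =>
    simp only [Tm.sizeEval, ih]
    rfl
  | par _ _ ih₁ ih₂ =>
    simp only [Tm.sizeEval, ih₁, ih₂]
    rfl
  | pabs _ ih =>
    simp only [Tm.sizeEval, ih]
    rfl
  | papp _ h ih₁ ih₂ =>
    simp only [Tm.sizeEval, ih₁, ih₂]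
    rfl
  | nabs _ ih => exact ih e
  | napp n _ ih => exact ih e
  | par_assoc P Q R => exact Nat.add_assoc _ _ _
  | par_comm P Q => exact Nat.add_comm _ _
  | par_nil P => exact Nat.add_zero _
  | papp_pabs P A =>
    rw [Tm.inst_eq, Tm.sizeEval_subst, map_cons fun U (Q : Tm _ U) => Q.sizeEval e]
    rfl
  | napp_nabs P n =>
    rw [Tm.ninst_eq, Tm.sizeEval_subst]
    rfl

/-- The size of the normal form of a term. -/
noncomputable def Tm.size {T : Ty S} (P : Tm ob T) : ℕ :=
  sizeReify T (P.sizeEval fun U _ => sizeReflect U)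

theorem SC.size_eq {T : Ty S} {P Q : Tm ob T} (h : SC P Q) : P.size = Q.size :=
  congrArg (sizeReify T) (h.sizeEval_eq _)

theorem Tm.size_rename {T : Ty S} (P : Tm ob T) (p : Ren (Ty S)) (r : Ren S) :
    (P.rename p r).size = P.size := by
  simp only [size, sizeEval_rename]

theorem cons_sizeReflect (T : Ty S) :
    cons T (sizeReflect T) (fun U _ => sizeReflect U) = fun U _ => sizeReflect U :=
  cons_self_shift T (fun U _ => sizeReflect U)

theorem Tm.size_nil : (Tm.nil : Proc ob).size = 0 := by
  simp only [size, sizeEval, sizeReify]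

theorem Tm.size_par (P Q : Proc ob) : (Tm.par P Q).size = P.size + Q.size := by
  simp only [size, sizeEval, sizeReify]
  rfl

theorem Tm.size_pabs {T : Ty S} (P : Proc ob) : (Tm.pabs (T := T) P).size = P.size + 1 := by
  simp only [size, sizeEval, sizeReify, cons_sizeReflect]

theorem Tm.size_nabs {s : S} (P : Proc ob) : (Tm.nabs (s := s) P).size = P.size + 1 := by
  simp only [size, sizeEval, sizeReify]

/-- The size of a component. -/
noncomputable def Hd.size : Hd ob (Tm ob) → ℕ
  | .inp _ P => P.size + 1
  | .out _ A => A.size + 1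
  | .var _ => 1
  | .papp _ A => A.size + 1
  | .napp _ _ => 1

theorem Hd.size_toTm (h : Hd ob (Tm ob)) : h.toTm.size = h.size := by
  cases h with
  | inp m P =>
    simp only [toTm, size, Tm.size, Tm.sizeEval, sizeReify, cons_sizeReflect]
  | out m A => simp only [toTm, size, Tm.size, Tm.sizeEval, sizeReify]
  | var i => simp only [toTm, size, Tm.size, Tm.sizeEval, sizeReify, sizeReflect]
  | papp i A =>
    simp only [toTm, size, Tm.size, Tm.sizeEval, sizeReify, sizeReflect]
  | napp i n => simp only [toTm, size, Tm.size, Tm.sizeEval, sizeReify, sizeReflect]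

end Size

-- Bisimilarity: equivalence, compatibility and invariance of size

section Bisimilarity

variable {S : Type u} {ob : S → Ty S}

/-- What a process becomes when a component in parallel to it acts. -/
noncomputable def Hd.frame {K : Ty S → Type u} : Hd ob K → Proc ob → Proc ob
  | .inp (s := s) _ _, R => R.weaken (ob s)
  | _, R => R

/-- What remains of `h | R` after the component `h` has been consumed. -/
noncomputable def Hd.cont : Hd ob (Tm ob) → Proc ob → Proc ob
  | .inp (s := s) _ A, R => .par A (R.weaken (ob s))
  | _, R => R

/-- Components that give rise to the same observation, up to the relation `R` between the terms
that are observed. -/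
inductive Hd.Match (R : ∀ ⦃T : Ty S⦄, Tm ob T → Tm ob T → Prop) :
    Hd ob (Tm ob) → Hd ob (Tm ob) → Prop
  -- The bodies are deliberately unrelated: an input reveals its body only in parallel with the rest
  -- of the process, and `Hd.cont` compares the two together.
  | inp {s : S} (m : Nm s) (A B : Proc ob) : Match R (.inp m A) (.inp m B)
  | out {s : S} (m : Nm s) {A B : Tm ob (ob s)} : R A B → Match R (.out m A) (.out m B)
  | var (i : ℕ) : Match R (.var i) (.var i)
  | papp {T : Ty S} (i : ℕ) {A B : Tm ob T} : R A B → Match R (.papp i A) (.papp i B)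
  | napp {s : S} (i : ℕ) (n : Nm s) : Match R (.napp i n) (.napp i n)

theorem Hd.Match.mono {R R' : ∀ ⦃T : Ty S⦄, Tm ob T → Tm ob T → Prop}
    (hR : ∀ ⦃T : Ty S⦄ ⦃P Q : Tm ob T⦄, R P Q → R' P Q) {h h' : Hd ob (Tm ob)}
    (hh : h.Match R h') : h.Match R' h' := by
  cases hh with
  | inp m A B => exact .inp m A B
  | out m h => exact .out m (hR h)
  | var i => exact .var i
  | papp i h => exact .papp i (hR h)
  | napp i n => exact .napp i n

theorem Hd.match_of_mk_eq {R : ∀ ⦃T : Ty S⦄, Tm ob T → Tm ob T → Prop}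
    (hR : ∀ ⦃T : Ty S⦄ ⦃P Q : Tm ob T⦄, SC P Q → R P Q) {h h' : Hd ob (Tm ob)}
    (e : h.mk = h'.mk) : h.Match R h' := by
  cases h <;> cases h' <;> simp only [mk, map, reduceCtorEq] at e
  · rename_i s m A s' m' A'
    obtain ⟨rfl, e1, -⟩ := Hd.inp.inj e
    cases e1
    exact .inp _ _ _
  · rename_i s m A s' m' A'
    obtain ⟨rfl, e1, e2⟩ := Hd.out.inj e
    cases e1
    exact .out _ (hR (Tm.mk_eq_mk.1 (eq_of_heq e2)))
  · cases e
    exact .var _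
  · rename_i T i A T' i' A'
    obtain ⟨rfl, rfl, e2⟩ := Hd.papp.inj e
    exact .papp _ (hR (Tm.mk_eq_mk.1 (eq_of_heq e2)))
  · cases e
    exact .napp _ _

theorem Hd.Match.trans {R R' R'' : ∀ ⦃T : Ty S⦄, Tm ob T → Tm ob T → Prop}
    (hR : ∀ ⦃T : Ty S⦄ ⦃P Q Q' : Tm ob T⦄, R P Q → R' Q Q' → R'' P Q') {h h' h'' : Hd ob (Tm ob)}
    (hh : h.Match R h') (hh' : h'.Match R' h'') : h.Match R'' h'' := by
  cases hh with
  | inp m A B => cases hh' with | inp _ _ _ => exact .inp _ _ _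
  | out m h => cases hh' with | out _ h' => exact .out _ (hR h h')
  | var i => cases hh' with | var _ => exact .var _
  | papp i h => cases hh' with | papp _ h' => exact .papp _ (hR h h')
  | napp i n => cases hh' with | napp _ _ => exact .napp _ _

theorem Hd.cont_congr (h : Hd ob (Tm ob)) {P Q : Proc ob} (hs : SC P Q) :
    SC (h.cont P) (h.cont Q) := by
  cases h with
  | inp m A => exact .par (.refl _) (hs.rename _ _)
  | _ => exact hs

theorem Hd.cont_par (h : Hd ob (Tm ob)) (P Q : Proc ob) :
    SC (h.cont (.par P Q)) (.par (h.cont P) (h.frame Q)) := by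
  cases h with
  | inp m A => exact (SC.par_assoc _ _ _).symm
  | _ => exact .refl _

theorem Hd.cont_of_mk_eq {h h' : Hd ob (Tm ob)} (e : h.mk = h'.mk) (P : Proc ob) :
    SC (h.cont P) (h'.cont P) := by
  cases h <;> cases h' <;> simp only [mk, map, reduceCtorEq] at e
  · rename_i s m A s' m' A'
    obtain ⟨rfl, e1, e2⟩ := Hd.inp.inj e
    exact .par (Tm.mk_eq_mk.1 e2) (.refl _)
  all_goals exact .refl _

theorem Hd.frame_eq_of_match {R : ∀ ⦃T : Ty S⦄, Tm ob T → Tm ob T → Prop} {h h' : Hd ob (Tm ob)}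
    (hh : h.Match R h') : h.frame = h'.frame := by
  cases hh <;> rfl

/-- The parallel rules only carry passive components along and `struct` is absorbed by congruence,
so a transition is the peeling off of a component. -/
theorem step_inp_iff {s : S} {m : Nm s} {P P' : Proc ob} :
    Step (.inp m) P P' ↔
      ∃ A P₀, SC P (.par (.inp m A) P₀) ∧ SC P' (.par A (P₀.weaken (ob s))) := by
  constructor
  · intro h
    generalize ha : Act.inp m = a at h
    induction h with
    | inp m P =>
      cases ha
      exact ⟨P, .nil, (SC.par_nil _).symm, (SC.par_nil _).symm⟩
    | out => cases ha
    | parL Q _ ih =>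
      obtain ⟨A, P₀, h₁, h₂⟩ := ih ha
      subst ha
      exact ⟨A, .par P₀ Q, (SC.par h₁ (.refl _)).trans (.par_assoc _ _ _),
        (SC.par h₂ (.refl _)).trans (.par_assoc _ _ _)⟩
    | parR Q _ ih =>
      obtain ⟨A, P₀, h₁, h₂⟩ := ih ha
      subst ha
      refine ⟨A, .par P₀ Q, ?_, ?_⟩
      · exact (SC.par_comm _ _).trans ((SC.par h₁ (.refl _)).trans (.par_assoc _ _ _))
      · exact (SC.par_comm _ _).trans ((SC.par h₂ (.refl _)).trans (.par_assoc _ _ _))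
    | comL => cases ha
    | comR => cases ha
    | struct h₁ _ h₂ ih =>
      obtain ⟨A, P₀, h₃, h₄⟩ := ih ha
      exact ⟨A, P₀, h₁.trans h₃, h₂.symm.trans h₄⟩
  · rintro ⟨A, P₀, h₁, h₂⟩
    exact .struct h₁ (.parL P₀ (.inp m A)) h₂.symm

theorem step_out_iff {s : S} {m : Nm s} {A : Tm ob (ob s)} {P P' : Proc ob} :
    Step (.out m A) P P' ↔ SC P (.par (.out m A) P') := by
  constructor
  · intro h
    generalize ha : Act.out m A = a at h
    induction h with
    | inp => cases ha
    | out m A =>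
      cases ha
      exact (SC.par_nil _).symm
    | parL Q _ ih =>
      have h₁ := ih ha
      subst ha
      exact (SC.par h₁ (.refl _)).trans (.par_assoc _ _ _)
    | parR Q _ ih =>
      have h₁ := ih ha
      subst ha
      refine (SC.par_comm _ _).trans ((SC.par h₁ (.refl _)).trans ((SC.par_assoc _ _ _).trans ?_))
      exact .par (.refl _) (.par_comm _ _)
    | comL => cases ha
    | comR => cases ha
    | struct h₁ _ h₂ ih => exact h₁.trans ((ih ha).trans (.par (.refl _) h₂))
  · intro h
    exact .struct h (.parL P' (.out m A)) ((SC.par_comm _ _).trans (.par_nil _))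

/-- Unifies the clauses for outputs, inputs and the three kinds of top-level variable. The residual
`Q''` is kept apart from `k'.cont Q'` because `R` need not be closed under congruence. -/
theorem IsHOIOBisimulation.hd {R : ∀ ⦃T : Ty S⦄, Tm ob T → Tm ob T → Prop}
    (hR : IsHOIOBisimulation R) {P Q P' : Proc ob} (h : R P Q) {k : Hd ob (Tm ob)}
    (hk : SC P (.par k.toTm P')) :
    ∃ (k' : Hd ob (Tm ob)) (Q' Q'' : Proc ob), SC Q (.par k'.toTm Q') ∧ k.Match R k' ∧
      SC (k'.cont Q') Q'' ∧ R (k.cont P') Q'' := by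
  cases k with
  | inp m A =>
    obtain ⟨Q'', hQ, hPQ⟩ := hR.inp h m _ (step_inp_iff.2 ⟨A, P', hk, .refl _⟩)
    obtain ⟨B, Q', h₁, h₂⟩ := step_inp_iff.1 hQ
    exact ⟨.inp m B, Q', Q'', h₁, .inp _ _ _, h₂.symm, hPQ⟩
  | out m A =>
    obtain ⟨B, Q', hQ, hAB, hPQ⟩ := hR.out h m A P' (step_out_iff.2 hk)
    exact ⟨.out m B, Q', Q', step_out_iff.1 hQ, .out _ hAB, .refl _, hPQ⟩
  | var i =>
    obtain ⟨Q', hQ, hPQ⟩ := hR.var h i P' hk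
    exact ⟨.var i, Q', Q', hQ, .var i, .refl _, hPQ⟩
  | papp i A =>
    obtain ⟨B, Q', hQ, hAB, hPQ⟩ := hR.papp h i A P' hk
    exact ⟨.papp i B, Q', Q', hQ, .papp _ hAB, .refl _, hPQ⟩
  | napp i n =>
    obtain ⟨Q', hQ, hPQ⟩ := hR.napp h i n P' hk
    exact ⟨.napp i n, Q', Q', hQ, .napp i n, .refl _, hPQ⟩

/-- Converse to `IsHOIOBisimulation.hd`. The hypothesis `sc_left` is needed for inputs, whose target
is determined only up to congruence. -/
theorem IsHOIOBisimulation.of_hd {R : ∀ ⦃T : Ty S⦄, Tm ob T → Tm ob T → Prop}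
    (symm : ∀ ⦃T : Ty S⦄ ⦃P Q : Tm ob T⦄, R P Q → R Q P)
    (non_abs : ∀ ⦃T : Ty S⦄ ⦃P Q : Tm ob T⦄, R P Q → ¬ P.IsAbs → ¬ Q.IsAbs)
    (pabs : ∀ ⦃T : Ty S⦄ ⦃A : Proc ob⦄ ⦃Q : Tm ob (.pabs T)⦄, R (.pabs A) Q →
      ∃ B : Proc ob, Q = .pabs B ∧ R A B)
    (nabs : ∀ ⦃s : S⦄ ⦃A : Proc ob⦄ ⦃Q : Tm ob (.nabs s)⦄, R (.nabs A) Q →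
      ∃ B : Proc ob, Q = .nabs B ∧ R A B)
    (var_abs : ∀ ⦃T : Ty S⦄, T ≠ .proc → ∀ ⦃P Q : Tm ob T⦄, R P Q → ∀ i : ℕ,
      SC P (.var i) → SC Q (.var i))
    (sc_left : ∀ ⦃P P' Q : Proc ob⦄, SC P P' → R P' Q → R P Q)
    (hd : ∀ ⦃P Q : Proc ob⦄, R P Q → ∀ (k : Hd ob (Tm ob)) (P' : Proc ob), SC P (.par k.toTm P') →
      ∃ (k' : Hd ob (Tm ob)) (Q' : Proc ob), SC Q (.par k'.toTm Q') ∧ k.Match R k' ∧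
        R (k.cont P') (k'.cont Q')) :
    IsHOIOBisimulation R where
  symm := symm
  non_abs := non_abs
  pabs := pabs
  nabs := nabs
  var_abs := var_abs
  out P Q h s m A P' hs := by
    obtain ⟨k, Q', hQ, hk, hPQ⟩ := hd h (.out m A) P' (step_out_iff.1 hs)
    cases hk with
    | out m hAB => exact ⟨_, Q', step_out_iff.2 hQ, hAB, hPQ⟩
  inp P Q h s m P' hs := by
    obtain ⟨A, P₀, h₁, h₂⟩ := step_inp_iff.1 hs
    obtain ⟨k, Q', hQ, hk, hPQ⟩ := hd h (.inp m A) P₀ h₁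
    cases hk with
    | inp m A B => exact ⟨_, step_inp_iff.2 ⟨B, Q', hQ, .refl _⟩, sc_left h₂ hPQ⟩
  var P Q h i P' hs := by
    obtain ⟨k, Q', hQ, hk, hPQ⟩ := hd h (.var i) P' hs
    cases hk with
    | var i => exact ⟨Q', hQ, hPQ⟩
  papp P Q h T i A P' hs := by
    obtain ⟨k, Q', hQ, hk, hPQ⟩ := hd h (.papp i A) P' hs
    cases hk with
    | papp i hAB => exact ⟨_, Q', hQ, hAB, hPQ⟩
  napp P Q h s i n P' hs := by
    obtain ⟨k, Q', hQ, hk, hPQ⟩ := hd h (.napp i n) P' hs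
    cases hk with
    | napp i n => exact ⟨Q', hQ, hPQ⟩

theorem isHOIOBisimulation_bisim :
    IsHOIOBisimulation (fun (T : Ty S) (P Q : Tm ob T) => Bisim P Q) where
  symm := fun _ _ _ ⟨R, hR, h⟩ => ⟨R, hR, hR.symm h⟩
  non_abs := fun _ _ _ ⟨_, hR, h⟩ => hR.non_abs h
  pabs := fun _ _ _ ⟨R, hR, h⟩ =>
    let ⟨B, hB, hAB⟩ := hR.pabs h
    ⟨B, hB, R, hR, hAB⟩
  nabs := fun _ _ _ ⟨R, hR, h⟩ =>
    let ⟨B, hB, hAB⟩ := hR.nabs h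
    ⟨B, hB, R, hR, hAB⟩
  out := fun _ _ ⟨R, hR, h⟩ _ m A P' hs =>
    let ⟨B, Q', hQ, hAB, hPQ⟩ := hR.out h m A P' hs
    ⟨B, Q', hQ, ⟨R, hR, hAB⟩, ⟨R, hR, hPQ⟩⟩
  inp := fun _ _ ⟨R, hR, h⟩ _ m P' hs =>
    let ⟨Q', hQ, hPQ⟩ := hR.inp h m P' hs
    ⟨Q', hQ, R, hR, hPQ⟩
  var := fun _ _ ⟨R, hR, h⟩ i P' hs =>
    let ⟨Q', hQ, hPQ⟩ := hR.var h i P' hs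
    ⟨Q', hQ, R, hR, hPQ⟩
  var_abs := fun _ hT _ _ ⟨_, hR, h⟩ => hR.var_abs hT h
  papp := fun _ _ ⟨R, hR, h⟩ _ i A P' hs =>
    let ⟨B, Q', hQ, hAB, hPQ⟩ := hR.papp h i A P' hs
    ⟨B, Q', hQ, ⟨R, hR, hAB⟩, ⟨R, hR, hPQ⟩⟩
  napp := fun _ _ ⟨R, hR, h⟩ _ i n P' hs =>
    let ⟨Q', hQ, hPQ⟩ := hR.napp h i n P' hs
    ⟨Q', hQ, R, hR, hPQ⟩

theorem isHOIOBisimulation_sc :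
    IsHOIOBisimulation (fun (T : Ty S) (P Q : Tm ob T) => SC P Q) :=
  .of_hd (fun _ _ _ h => h.symm) (fun _ _ _ h => (not_congr h.isAbs_iff).1)
    (fun _ _ _ h => h.pabs_left) (fun _ _ _ h => h.nabs_left)
    (fun _ _ _ _ h _ hs => h.symm.trans hs) (fun _ _ _ h h' => h.trans h')
    fun _ _ h k P' hs => ⟨k, P', h.symm.trans hs, k.match_of_mk_eq (fun _ _ _ h => h) rfl, .refl _⟩

theorem SC.bisim {T : Ty S} {P Q : Tm ob T} (h : SC P Q) : Bisim P Q :=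
  ⟨_, isHOIOBisimulation_sc, h⟩

theorem Bisim.refl {T : Ty S} (P : Tm ob T) : Bisim P P := (SC.refl P).bisim

theorem Bisim.symm {T : Ty S} {P Q : Tm ob T} (h : Bisim P Q) : Bisim Q P :=
  isHOIOBisimulation_bisim.symm h

theorem Bisim.trans {T : Ty S} {P Q R : Tm ob T} (h : Bisim P Q) (h' : Bisim Q R) :
    Bisim P R := by
  have hB := isHOIOBisimulation_bisim (ob := ob)
  refine ⟨fun U A C => ∃ B, Bisim A B ∧ Bisim B C, ?_, Q, h, h'⟩
  exact {
    symm := fun _ _ _ ⟨B, h₁, h₂⟩ => ⟨B, h₂.symm, h₁.symm⟩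
    non_abs := fun _ _ _ ⟨B, h₁, h₂⟩ h => hB.non_abs h₂ (hB.non_abs h₁ h)
    pabs := fun T _ _ ⟨B, h₁, h₂⟩ => by
      obtain ⟨B', rfl, h₃⟩ := hB.pabs h₁
      obtain ⟨C', rfl, h₄⟩ := hB.pabs h₂
      exact ⟨C', rfl, B', h₃, h₄⟩
    nabs := fun T _ _ ⟨B, h₁, h₂⟩ => by
      obtain ⟨B', rfl, h₃⟩ := hB.nabs h₁
      obtain ⟨C', rfl, h₄⟩ := hB.nabs h₂
      exact ⟨C', rfl, B', h₃, h₄⟩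
    out := fun _ _ ⟨_, h₁, h₂⟩ _ m _ _ hs =>
      let ⟨_, _, hs', a, b⟩ := hB.out h₁ m _ _ hs
      let ⟨_, _, hs'', a', b'⟩ := hB.out h₂ m _ _ hs'
      ⟨_, _, hs'', ⟨_, a, a'⟩, ⟨_, b, b'⟩⟩
    inp := fun _ _ ⟨_, h₁, h₂⟩ _ m _ hs =>
      let ⟨_, hs', b⟩ := hB.inp h₁ m _ hs
      let ⟨_, hs'', b'⟩ := hB.inp h₂ m _ hs'
      ⟨_, hs'', _, b, b'⟩
    var := fun _ _ ⟨_, h₁, h₂⟩ i _ hs =>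
      let ⟨_, hs', b⟩ := hB.var h₁ i _ hs
      let ⟨_, hs'', b'⟩ := hB.var h₂ i _ hs'
      ⟨_, hs'', _, b, b'⟩
    var_abs := fun _ hT _ _ ⟨_, h₁, h₂⟩ i hs => hB.var_abs hT h₂ i (hB.var_abs hT h₁ i hs)
    papp := fun _ _ ⟨_, h₁, h₂⟩ _ i _ _ hs =>
      let ⟨_, _, hs', a, b⟩ := hB.papp h₁ i _ _ hs
      let ⟨_, _, hs'', a', b'⟩ := hB.papp h₂ i _ _ hs'
      ⟨_, _, hs'', ⟨_, a, a'⟩, ⟨_, b, b'⟩⟩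
    napp := fun _ _ ⟨_, h₁, h₂⟩ _ i n _ hs =>
      let ⟨_, hs', b⟩ := hB.napp h₁ i n _ hs
      let ⟨_, hs'', b'⟩ := hB.napp h₂ i n _ hs'
      ⟨_, hs'', _, b, b'⟩ }

theorem Bisim.hd {P Q P' : Proc ob} (h : Bisim P Q) {k : Hd ob (Tm ob)}
    (hk : SC P (.par k.toTm P')) :
    ∃ (k' : Hd ob (Tm ob)) (Q' : Proc ob), SC Q (.par k'.toTm Q') ∧
      k.Match (fun _ A B => Bisim A B) k' ∧ Bisim (k.cont P') (k'.cont Q') := by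
  obtain ⟨k', Q', Q'', h₁, h₂, h₃, h₄⟩ := isHOIOBisimulation_bisim.hd h hk
  exact ⟨k', Q', h₁, h₂, h₄.trans h₃.symm.bisim⟩

/-- Renamings of bisimilar terms. -/
def RenameRel ⦃T : Ty S⦄ (X Y : Tm ob T) : Prop :=
  ∃ (P Q : Tm ob T) (p : Ren (Ty S)) (r : Ren S),
    Bisim P Q ∧ SC X (P.rename p r) ∧ SC Y (Q.rename p r)

theorem Tm.isAbs_rename {T : Ty S} (P : Tm ob T) (p : Ren (Ty S)) (r : Ren S) :
    (P.rename p r).IsAbs ↔ P.IsAbs := by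
  cases P <;> rfl

theorem Hd.match_rename {h h' : Hd ob (Tm ob)} (hh : h.Match (fun _ A B => Bisim A B) h')
    (p : Ren (Ty S)) (r : Ren S) : (h.rename p r).Match RenameRel (h'.rename p r) := by
  cases hh with
  | inp m A B => exact .inp _ _ _
  | out m h => exact .out _ ⟨_, _, p, r, h, .refl _, .refl _⟩
  | var i => exact .var _
  | papp i h => exact .papp _ ⟨_, _, p, r, h, .refl _, .refl _⟩
  | napp i n => exact .napp _ _

/-- By `SC.rename_split` each observation of a renamed process comes from one of the original
process. The relation ranges over all renamings because they are lifted under inputs and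
abstractions. -/
theorem isHOIOBisimulation_renameRel : IsHOIOBisimulation (RenameRel (ob := ob)) := by
  have hB := isHOIOBisimulation_bisim (ob := ob)
  refine .of_hd ?_ ?_ ?_ ?_ ?_ ?_ ?_
  · rintro T X Y ⟨P, Q, p, r, h, hX, hY⟩
    exact ⟨Q, P, p, r, h.symm, hY, hX⟩
  · rintro T X Y ⟨P, Q, p, r, h, hX, hY⟩ hn
    rw [hX.isAbs_iff, P.isAbs_rename] at hn
    rw [hY.isAbs_iff, Q.isAbs_rename]
    exact hB.non_abs h hn
  · rintro T A Y ⟨P, Q, p, r, h, hX, hY⟩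
    cases P with
    | var i => exact absurd (hX.isAbs_iff.1 trivial) id
    | pabs P =>
      obtain ⟨Q, rfl, hPQ⟩ := hB.pabs h
      obtain ⟨B, rfl, hB'⟩ := hY.symm.pabs_left
      obtain ⟨A', hA', hA⟩ := hX.pabs_left
      cases hA'
      exact ⟨B, rfl, P, Q, _, r, hPQ, hA, hB'.symm⟩
  · rintro s A Y ⟨P, Q, p, r, h, hX, hY⟩
    cases P with
    | var i => exact absurd (hX.isAbs_iff.1 trivial) id
    | nabs P =>
      obtain ⟨Q, rfl, hPQ⟩ := hB.nabs h
      obtain ⟨B, rfl, hB'⟩ := hY.symm.nabs_left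
      obtain ⟨A', hA', hA⟩ := hX.nabs_left
      cases hA'
      exact ⟨B, rfl, P, Q, p, _, hPQ, hA, hB'.symm⟩
  · rintro T hT X Y ⟨P, Q, p, r, h, hX, hY⟩ i hi
    have hP := (hi.symm.trans hX).var_left hT
    cases P with
    | var j =>
      have hQ := ((hB.var_abs hT h j (.refl _)).symm.var_left hT)
      subst hQ
      rw [← hP]
      exact hY
    | pabs => simp [Tm.rename] at hP
    | nabs => simp [Tm.rename] at hP
    | _ => exact absurd rfl hT
  · rintro X X' Y hs ⟨P, Q, p, r, h, hX, hY⟩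
    exact ⟨P, Q, p, r, h, hs.trans hX, hY⟩
  · rintro X Y ⟨P, Q, p, r, h, hX, hY⟩ k X' hk
    obtain ⟨k₁, P', hP', hk₁, hX'⟩ := (hX.symm.trans hk).rename_split
    obtain ⟨k₂, Q', hQ', hk₂, hPQ'⟩ := h.hd hP'
    refine ⟨k₂.rename p r, Q'.rename p r, ?_, ?_, ?_⟩
    · have := hY.trans (hQ'.rename p r)
      simpa only [Tm.rename, Hd.rename_toTm] using this
    · refine Hd.Match.trans (R := fun _ A B => SC A B) ?_
        (Hd.match_of_mk_eq (fun _ _ _ h => h) hk₁.symm) (Hd.match_rename hk₂ p r)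
      rintro T A B C hAB ⟨P, Q, p, r, h, hX, hY⟩
      exact ⟨P, Q, p, r, h, hAB.trans hX, hY⟩
    · have h₁ : SC (k.cont X') ((k₁.rename p r).cont (P'.rename p r)) :=
        (k.cont_congr hX').trans (Hd.cont_of_mk_eq hk₁.symm _)
      cases hk₂ with
      | @inp s m A B =>
        refine ⟨_, _, p.lift (ob s), r, hPQ', h₁.trans ?_, ?_⟩ <;>
        · simp only [Hd.cont, Hd.rename, Tm.rename, Tm.rename_weaken]
          exact .refl _
      | _ => exact ⟨_, _, p, r, hPQ', h₁, .refl _⟩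

theorem Bisim.rename {T : Ty S} {P Q : Tm ob T} (h : Bisim P Q) (p : Ren (Ty S)) (r : Ren S) :
    Bisim (P.rename p r) (Q.rename p r) :=
  ⟨_, isHOIOBisimulation_renameRel, P, Q, p, r, h, .refl _, .refl _⟩

/-- Parallel compositions of bisimilar processes, and bisimilar terms. -/
inductive ParRel : ∀ ⦃T : Ty S⦄, Tm ob T → Tm ob T → Prop
  | par {X Y P P' Q Q' : Proc ob} : Bisim P P' → Bisim Q Q' → SC X (.par P Q) →
      SC Y (.par P' Q') → ParRel X Y
  | bisim {T : Ty S} {P Q : Tm ob T} : Bisim P Q → ParRel P Q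

/-- `SC.par_split` tells which side acts; the other side is at most weakened, which `Bisim.rename`
allows. The constructor `ParRel.bisim` covers emitted terms, arguments and bodies of abstractions.
-/
theorem isHOIOBisimulation_parRel : IsHOIOBisimulation (ParRel (ob := ob)) := by
  have hB := isHOIOBisimulation_bisim (ob := ob)
  refine .of_hd ?_ ?_ ?_ ?_ ?_ ?_ ?_
  · rintro T X Y (⟨h₁, h₂, h₃, h₄⟩ | h)
    · exact .par h₁.symm h₂.symm h₄ h₃
    · exact .bisim h.symm
  · rintro T X Y (⟨h₁, h₂, h₃, h₄⟩ | h) hn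
    · exact Tm.not_isAbs_iff.2 (.inl rfl)
    · exact hB.non_abs h hn
  · rintro T A Y h
    cases h with
    | bisim h =>
      obtain ⟨B, rfl, hAB⟩ := hB.pabs h
      exact ⟨B, rfl, .bisim hAB⟩
  · rintro T A Y h
    cases h with
    | bisim h =>
      obtain ⟨B, rfl, hAB⟩ := hB.nabs h
      exact ⟨B, rfl, .bisim hAB⟩
  · rintro T hT X Y (⟨h₁, h₂, h₃, h₄⟩ | h)
    · exact absurd rfl hT
    · exact hB.var_abs hT h
  · intro X X' Y hs h
    cases h with
    | par h₁ h₂ h₃ h₄ => exact .par h₁ h₂ (hs.trans h₃) h₄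
    | bisim h => exact .bisim (hs.bisim.trans h)
  · have hframe : ∀ (k : Hd ob (Tm ob)) {P Q : Proc ob}, Bisim P Q →
        Bisim (k.frame P) (k.frame Q) := by
      intro k P Q h
      cases k with
      | inp => exact h.rename _ _
      | _ => exact h
    intro X Y h k X' hk
    cases h with
    | @par _ _ P P' Q Q' h₁ h₂ h₃ h₄ =>
      rcases (h₃.symm.trans hk).par_split with ⟨P₁, hP₁, hX'⟩ | ⟨Q₁, hQ₁, hX'⟩
      · obtain ⟨k', P₂, hP₂, hm, hb⟩ := h₁.hd hP₁
        refine ⟨k', .par P₂ Q', ?_, hm.mono fun _ _ _ h => .bisim h, ?_⟩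
        · exact h₄.trans ((SC.par hP₂ (.refl _)).trans (.par_assoc _ _ _))
        · refine .par hb (hframe k h₂) ((k.cont_congr hX').trans (k.cont_par _ _)) ?_
          rw [Hd.frame_eq_of_match hm]
          exact k'.cont_par _ _
      · obtain ⟨k', Q₂, hQ₂, hm, hb⟩ := h₂.hd hQ₁
        refine ⟨k', .par Q₂ P', ?_, hm.mono fun _ _ _ h => .bisim h, ?_⟩
        · exact h₄.trans ((SC.par_comm _ _).trans
            ((SC.par hQ₂ (.refl _)).trans (.par_assoc _ _ _)))
        · refine .par hb (hframe k h₁)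
            ((k.cont_congr (hX'.trans (.par_comm _ _))).trans (k.cont_par _ _)) ?_
          rw [Hd.frame_eq_of_match hm]
          exact k'.cont_par _ _
    | bisim h =>
      obtain ⟨k', Q', h₁, h₂, h₃⟩ := h.hd hk
      exact ⟨k', Q', h₁, h₂.mono fun _ _ _ h => .bisim h, .bisim h₃⟩

theorem Bisim.par {P P' Q Q' : Proc ob} (h₁ : Bisim P P') (h₂ : Bisim Q Q') :
    Bisim (.par P Q) (.par P' Q') :=
  ⟨_, isHOIOBisimulation_parRel, .par h₁ h₂ (.refl _) (.refl _)⟩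

theorem SC.size_par_hd {P P' : Proc ob} {k : Hd ob (Tm ob)} (h : SC P (.par k.toTm P')) :
    P.size = k.size + P'.size := by
  rw [h.size_eq, Tm.size_par, k.size_toTm]

theorem Hd.size_cont_lt (k : Hd ob (Tm ob)) (P : Proc ob) : (k.cont P).size < k.size + P.size := by
  cases k <;> simp only [cont, size, Tm.size_par, Tm.weaken, Tm.size_rename] <;> omega

/-- Strong induction on size. Matching components and what remains after them have equal sizes by
induction; for an input, body and remainder are counted together. -/
theorem Bisim.size_eq {T : Ty S} {P Q : Tm ob T} (h : Bisim P Q) : P.size = Q.size := by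
  have hB := isHOIOBisimulation_bisim (ob := ob)
  induction hn : P.size using Nat.strong_induction_on generalizing T P Q with
  | _ n ih =>
    -- Stated apart because at type `proc` the argument depends on components and not on the
    -- outermost constructor.
    have hproc : ∀ {P Q : Proc ob}, Bisim P Q → P.size = n → n = Q.size := by
      clear h hn P Q
      intro P Q h hn
      rcases sc_nil_or_exists_hd P with h0 | ⟨k, P', hk⟩
      · rcases sc_nil_or_exists_hd Q with h0' | ⟨k, Q', hk⟩
        · rw [← hn, h0.size_eq, h0'.size_eq]
        · obtain ⟨k', P', hk', -⟩ := h.symm.hd hk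
          exact absurd (h0.symm.trans hk') not_sc_nil_par
      · obtain ⟨k', Q', hk', hm, hb⟩ := h.hd hk
        have hP := hk.size_par_hd
        have hQ := hk'.size_par_hd
        have hlt := k.size_cont_lt P'
        have hc := ih _ (by omega) hb rfl
        cases hm with
        | inp m A B =>
          simp only [Hd.cont, Hd.size, Tm.size_par, Tm.weaken, Tm.size_rename] at *
          omega
        | out m hAB =>
          simp only [Hd.cont, Hd.size] at *
          have := ih _ (by omega) hAB rfl
          omega
        | var i =>
          simp only [Hd.cont, Hd.size] at *
          omega
        | papp i hAB =>
          simp only [Hd.cont, Hd.size] at *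
          have := ih _ (by omega) hAB rfl
          omega
        | napp i n =>
          simp only [Hd.cont, Hd.size] at *
          omega
    cases P with
    | pabs A =>
      obtain ⟨B, rfl, hAB⟩ := hB.pabs h
      rw [Tm.size_pabs] at hn ⊢
      have := ih _ (by omega) hAB rfl
      omega
    | nabs A =>
      obtain ⟨B, rfl, hAB⟩ := hB.nabs h
      rw [Tm.size_nabs] at hn ⊢
      have := ih _ (by omega) hAB rfl
      omega
    | var i =>
      by_cases hT : T = .proc
      · subst hT
        exact hproc h hn
      · have hQ := ((hB.var_abs hT h i (.refl _)).symm.var_left hT)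
        rw [hQ, ← hn]
    | _ => exact hproc h hn

theorem Tm.sc_nil_of_size_eq_zero {P : Proc ob} (h : P.size = 0) : SC P .nil := by
  rcases sc_nil_or_exists_hd P with h0 | ⟨k, P', hk⟩
  · exact h0
  · have h₁ := hk.size_par_hd
    have h₂ := k.size_cont_lt P'
    omega

end Bisimilarity

end HOmp

-- Unique decomposition in commutative monoids with transitions

section UniqueDecomposition

variable {M Λ : Type*} [AddCommMonoid M]

/-- Elements of a commutative monoid that are not zero and cannot be split into two nonzero
summands. -/
def Indecomposable (x : M) : Prop := x ≠ 0 ∧ ∀ y z, x = y + z → y = 0 ∨ z = 0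

/-- A commutative monoid with an additive weight and labelled transitions that decrease the weight
and, up to the injections `frame`, act on one summand of a sum only. -/
structure DecompositionSystem (M Λ : Type*) [AddCommMonoid M] where
  weight : M →+ ℕ
  tr : Λ → M → M → Prop
  frame : Λ → M →+ M
  eq_zero_of_weight : ∀ x, weight x = 0 → x = 0
  weight_frame : ∀ l x, weight (frame l x) = weight x
  frame_injective : ∀ l, Function.Injective (frame l)
  indecomposable_frame : ∀ l x, Indecomposable x → Indecomposable (frame l x)
  weight_lt : ∀ {l x x'}, tr l x x' → weight x' < weight x
  exists_tr : ∀ x, x ≠ 0 → ∃ l x', tr l x x'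
  tr_add_left : ∀ {l x x'} (y), tr l x x' → tr l (x + y) (x' + frame l y)
  tr_add : ∀ {l x y z}, tr l (x + y) z →
    (∃ x', tr l x x' ∧ z = x' + frame l y) ∨ (∃ y', tr l y y' ∧ z = y' + frame l x)

namespace DecompositionSystem

variable (D : DecompositionSystem M Λ)

theorem weight_pos {x : M} (h : x ≠ 0) : 0 < D.weight x :=
  Nat.pos_of_ne_zero fun h0 => h (D.eq_zero_of_weight x h0)

theorem exists_decomposition (D : DecompositionSystem M Λ) (x : M) :
    ∃ s : Multiset M, (∀ a ∈ s, Indecomposable a) ∧ s.sum = x := by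
  induction hn : D.weight x using Nat.strong_induction_on generalizing x with
  | _ n ih =>
    by_cases h0 : x = 0
    · exact ⟨0, by simp, by simp [h0]⟩
    by_cases hx : Indecomposable x
    · exact ⟨{x}, by simpa using hx, by simp⟩
    have hsplit : ∃ y z, x = y + z ∧ y ≠ 0 ∧ z ≠ 0 := by
      by_contra hcon
      refine hx ⟨h0, fun y z hyz => ?_⟩
      by_contra hyz'
      exact hcon ⟨y, z, hyz, fun h => hyz' (.inl h), fun h => hyz' (.inr h)⟩
    obtain ⟨y, z, rfl, hy, hz⟩ := hsplit
    have hy' := D.weight_pos hy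
    have hz' := D.weight_pos hz
    rw [map_add] at hn
    obtain ⟨s, hs, rfl⟩ := ih _ (by omega) y rfl
    obtain ⟨t, ht, rfl⟩ := ih _ (by omega) z rfl
    refine ⟨s + t, ?_, by simp⟩
    intro a ha
    rcases Multiset.mem_add.1 ha with ha | ha
    · exact hs a ha
    · exact ht a ha

open Classical in
theorem tr_sum {l : Λ} {s : Multiset M} {z : M} (h : D.tr l s.sum z) :
    ∃ a ∈ s, ∃ a', D.tr l a a' ∧ z = a' + D.frame l (s.erase a).sum := by
  induction s using Multiset.induction_on generalizing z with
  | empty => exact absurd (D.weight_lt h) (by simp)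
  | cons b s ih =>
    rw [Multiset.sum_cons] at h
    rcases D.tr_add h with ⟨b', hb, rfl⟩ | ⟨y, hy, rfl⟩
    · exact ⟨b, by simp, b', hb, by simp⟩
    · obtain ⟨a, ha, a', haa', rfl⟩ := ih hy
      refine ⟨a, by simp [ha], a', haa', ?_⟩
      rw [Multiset.erase_cons_tail_of_mem ha, Multiset.sum_cons, map_add]
      abel

open Classical in
theorem tr_sum_of_mem {l : Λ} {s : Multiset M} {a a' : M} (ha : a ∈ s) (h : D.tr l a a') :
    D.tr l s.sum (a' + D.frame l (s.erase a).sum) := by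
  have := D.tr_add_left (s.erase a).sum h
  rwa [← Multiset.sum_cons, Multiset.cons_erase ha] at this

theorem weight_le_of_mem {s : Multiset M} {a : M} (ha : a ∈ s) : D.weight a ≤ D.weight s.sum := by
  obtain ⟨t, rfl⟩ := Multiset.exists_cons_of_mem ha
  simp

/-- A decomposition into indecomposable elements. -/
noncomputable def parts (x : M) : Multiset M := (D.exists_decomposition x).choose

theorem parts_indecomposable (x : M) : ∀ a ∈ D.parts x, Indecomposable a :=
  (D.exists_decomposition x).choose_spec.1

theorem sum_parts (x : M) : (D.parts x).sum = x := (D.exists_decomposition x).choose_spec.2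

theorem card_parts_le (x : M) : (D.parts x).card ≤ D.weight x := by
  have key : ∀ s : Multiset M, (∀ a ∈ s, Indecomposable a) → s.card ≤ D.weight s.sum := by
    intro s
    induction s using Multiset.induction_on with
    | empty => simp
    | cons a s ih =>
      intro h
      have h1 := D.weight_pos (h a (by simp)).1
      have h2 := ih fun b hb => h b (by simp [hb])
      simp only [Multiset.card_cons, Multiset.sum_cons, map_add]
      omega
  simpa only [D.sum_parts] using key _ (D.parts_indecomposable x)

-- No summand outweighs the whole, and `frame` preserves weight. In particular the residual of a
-- move of `c` contains no framed copy of `c`.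
open Classical in
theorem count_frame_parts_eq_zero {l : Λ} {c x : M} (h : D.weight x < D.weight c) :
    (D.parts x).count (D.frame l c) = 0 := by
  rw [Multiset.count_eq_zero]
  intro hmem
  have := D.weight_le_of_mem hmem
  rw [D.sum_parts, D.weight_frame] at this
  omega

/-- Decompositions of elements of weight less than `N` are unique. -/
def UniqueBelow (N : ℕ) : Prop :=
  ∀ s t : Multiset M, (∀ a ∈ s, Indecomposable a) → (∀ a ∈ t, Indecomposable a) →
    s.sum = t.sum → D.weight s.sum < N → s = t

variable {D} {s t : Multiset M}

-- A move of a factor of `s` is a move of the common sum, hence of some factor of `t`. The target is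
-- lighter, so its two decompositions coincide; injectivity of `frame` turns the count of framed
-- copies among the passive factors into the count of `c`.
open Classical in
theorem UniqueBelow.match (hU : D.UniqueBelow (D.weight s.sum))
    (hs : ∀ a ∈ s, Indecomposable a) (ht : ∀ a ∈ t, Indecomposable a) (hst : s.sum = t.sum)
    {l : Λ} {a a' : M} (ha : a ∈ s) (haa' : D.tr l a a') :
    ∃ b ∈ t, ∃ b', D.tr l b b' ∧ ∀ c,
      (D.parts a').count (D.frame l c) + (s.erase a).count c =
        (D.parts b').count (D.frame l c) + (t.erase b).count c := by
  have h1 := D.tr_sum_of_mem ha haa'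
  have hlt := D.weight_lt h1
  rw [hst] at h1
  obtain ⟨b, hb, b', hbb', heq⟩ := D.tr_sum h1
  refine ⟨b, hb, b', hbb', fun c => ?_⟩
  have key := hU (D.parts a' + (s.erase a).map (D.frame l))
    (D.parts b' + (t.erase b).map (D.frame l)) ?_ ?_ ?_ ?_
  · have := congrArg (Multiset.count (D.frame l c)) key
    simpa only [Multiset.count_add, Multiset.count_map_eq_count' _ _ (D.frame_injective l)]
      using this
  · intro x hx
    rcases Multiset.mem_add.1 hx with hx | hx
    · exact D.parts_indecomposable _ x hx
    · obtain ⟨y, hy, rfl⟩ := Multiset.mem_map.1 hx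
      exact D.indecomposable_frame l y (hs y (Multiset.mem_of_mem_erase hy))
  · intro x hx
    rcases Multiset.mem_add.1 hx with hx | hx
    · exact D.parts_indecomposable _ x hx
    · obtain ⟨y, hy, rfl⟩ := Multiset.mem_map.1 hx
      exact D.indecomposable_frame l y (ht y (Multiset.mem_of_mem_erase hy))
  · simpa only [Multiset.sum_add, D.sum_parts, ← map_multiset_sum] using heq
  · simpa only [Multiset.sum_add, D.sum_parts, ← map_multiset_sum] using hlt

-- If some factor other than `c` is available, answering moves back and forth yields residuals with
-- ever more copies of `c`, beyond the weight of the sum. Otherwise `s` is a power of `c`, and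
-- counting leaves only the case that `c` itself splits.
open Classical in
theorem UniqueBelow.not_count_lt (hU : D.UniqueBelow (D.weight s.sum))
    (hs : ∀ a ∈ s, Indecomposable a) (ht : ∀ a ∈ t, Indecomposable a) (hst : s.sum = t.sum)
    {c : M} (hc : ∀ x, s.count x ≠ t.count x → D.weight x ≤ D.weight c) :
    ¬ t.count c < s.count c := by
  intro hlt
  have hcs : c ∈ s := Multiset.count_pos.1 (by omega)
  have hcpos := D.weight_pos (hs c hcs).1
  by_cases hex : ∃ a ∈ s, a ≠ c
  -- The answer `b` in `t` to the move of `a` must make up for the copies of `c` that `t` lacks, so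
  -- the count rises by at least one. Then `b` outweighs `c`, and maximality of `c` puts it back
  -- into `s`.
  · have grow : ∀ n, ∃ a ∈ s, a ≠ c ∧ ∃ l a', D.tr l a a' ∧
        n ≤ (D.parts a').count (D.frame l c) := by
      intro n
      induction n with
      | zero =>
        obtain ⟨a, ha, hac⟩ := hex
        obtain ⟨l, a', h⟩ := D.exists_tr a (hs a ha).1
        exact ⟨a, ha, hac, l, a', h, Nat.zero_le _⟩
      | succ n ih =>
        obtain ⟨a, ha, hac, l, a', haa', hn⟩ := ih
        obtain ⟨b, hb, b', hbb', hcount⟩ := hU.match hs ht hst ha haa'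
        have hcc := hcount c
        rw [Multiset.count_erase_of_ne hac.symm] at hcc
        have hw := D.weight_lt hbb'
        by_cases hbc : b = c
        · subst hbc
          rw [D.count_frame_parts_eq_zero hw, Multiset.count_erase_self] at hcc
          omega
        · rw [Multiset.count_erase_of_ne (Ne.symm hbc)] at hcc
          have hwc : D.weight c ≤ D.weight b' := by
            by_contra hcon
            rw [D.count_frame_parts_eq_zero (x := b') (by omega)] at hcc
            omega
          have hbs : s.count b = t.count b := by
            by_contra hne
            have := hc b hne
            omega
          have hbs' : b ∈ s := by
            rw [← Multiset.count_pos, hbs]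
            exact Multiset.count_pos.2 hb
          exact ⟨b, hbs', hbc, l, b', hbb', by omega⟩
    obtain ⟨a, ha, -, l, a', haa', hn⟩ := grow (D.weight s.sum)
    have h1 := D.weight_lt haa'
    have h2 := D.weight_le_of_mem ha
    have h3 := D.card_parts_le a'
    have h4 := Multiset.count_le_card (D.frame l c) (D.parts a')
    omega
  · have hall : ∀ a ∈ s, a = c := by
      intro a ha
      by_contra hne
      exact hex ⟨a, ha, hne⟩
    have hsr : s = Multiset.replicate (s.count c) c := by
      rw [Multiset.count_eq_card.2 fun a ha => (hall a ha).symm]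
      exact Multiset.eq_replicate_card.2 hall
    have htex : ∃ b ∈ t, b ≠ c := by
      by_contra hcon
      have htr : t = Multiset.replicate (t.count c) c := by
        have hall' : ∀ b ∈ t, b = c := fun b hb => by_contra fun h => hcon ⟨b, hb, h⟩
        rw [Multiset.count_eq_card.2 fun b hb => (hall' b hb).symm]
        exact Multiset.eq_replicate_card.2 hall'
      -- If both sides were powers of `c`, equal weights would force equal exponents.
      have hw := congrArg D.weight hst
      rw [hsr, htr, Multiset.sum_replicate, Multiset.sum_replicate, map_nsmul, map_nsmul,
        smul_eq_mul, smul_eq_mul] at hw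
      have := Nat.eq_of_mul_eq_mul_right hcpos hw
      omega
    obtain ⟨b, hb, hbc⟩ := htex
    have hwb : D.weight b ≤ D.weight c := by
      apply hc
      rw [Multiset.count_eq_zero.2 fun h => hbc (hall b h)]
      exact (Multiset.count_pos.2 hb).ne
    have hU' : D.UniqueBelow (D.weight t.sum) := hst ▸ hU
    -- A move of `b` is answered by a copy of `c`; neither residual is heavy enough to contain `c`,
    -- so `s` loses one copy while `t` keeps all of its own.
    have hct : t.count c + 1 = s.count c := by
      obtain ⟨l, b', hbb'⟩ := D.exists_tr b (ht b hb).1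
      obtain ⟨a, ha, a', haa', hcount⟩ := hU'.match ht hs hst.symm hb hbb'
      obtain rfl := hall a ha
      have hcc := hcount a
      have h1 := D.weight_lt haa'
      have h2 := D.weight_lt hbb'
      rw [D.count_frame_parts_eq_zero h1, D.count_frame_parts_eq_zero (by omega),
        Multiset.count_erase_of_ne (Ne.symm hbc), Multiset.count_erase_self] at hcc
      omega
    by_cases hcmem : c ∈ t
    -- If `t` contains `c`, a move of that copy removes exactly one copy on each side, so the
    -- multiplicities would be equal.
    · obtain ⟨l, c', hcc'⟩ := D.exists_tr c (ht c hcmem).1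
      obtain ⟨a, ha, a', haa', hcount⟩ := hU'.match ht hs hst.symm hcmem hcc'
      obtain rfl := hall a ha
      have hcc := hcount a
      rw [D.count_frame_parts_eq_zero (D.weight_lt haa'),
        D.count_frame_parts_eq_zero (D.weight_lt hcc'),
        Multiset.count_erase_self, Multiset.count_erase_self] at hcc
      have := Multiset.count_pos.2 hcmem
      omega
    -- Now `s` is the single element `c`, and `t` splits it into `b` and a rest.
    · rw [Multiset.count_eq_zero.2 hcmem] at hct
      rw [← hct, zero_add, Multiset.replicate_one] at hsr
      have hcb : c = b + (t.erase b).sum := by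
        rw [← Multiset.sum_cons, Multiset.cons_erase hb, ← hst, hsr, Multiset.sum_singleton]
      rcases (hs c hcs).2 _ _ hcb with h0 | h0
      · exact (ht b hb).1 h0
      · rw [h0, add_zero] at hcb
        exact hbc hcb.symm

/-- Decompositions into indecomposable elements are unique. -/
theorem unique_decomposition (D : DecompositionSystem M Λ) (hs : ∀ a ∈ s, Indecomposable a)
    (ht : ∀ a ∈ t, Indecomposable a) (hst : s.sum = t.sum) : s = t := by
  classical
  induction hn : D.weight s.sum using Nat.strong_induction_on generalizing s t with
  | _ n ih =>
    have hU : D.UniqueBelow (D.weight s.sum) := fun s' t' hs' ht' h hw =>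
      ih _ (hn ▸ hw) hs' ht' h rfl
    by_contra hne
    have hfin : ((s + t).toFinset.filter fun x => s.count x ≠ t.count x).Nonempty := by
      by_contra hcon
      rw [Finset.not_nonempty_iff_eq_empty] at hcon
      apply hne
      ext x
      by_contra hx
      have : x ∈ (s + t).toFinset.filter fun x => s.count x ≠ t.count x := by
        rw [Finset.mem_filter, Multiset.mem_toFinset, ← Multiset.count_pos, Multiset.count_add]
        exact ⟨by omega, hx⟩
      rw [hcon] at this
      simp at this
    -- A heaviest disagreement: `not_count_lt`, used in both directions, forces its multiplicities
    -- to agree after all.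
    obtain ⟨c, hc, hmax⟩ := Finset.exists_max_image _ D.weight hfin
    have hmax' : ∀ x, s.count x ≠ t.count x → D.weight x ≤ D.weight c := by
      intro x hx
      apply hmax
      rw [Finset.mem_filter, Multiset.mem_toFinset, ← Multiset.count_pos, Multiset.count_add]
      exact ⟨by omega, hx⟩
    have h1 := hU.not_count_lt hs ht hst hmax'
    have h2 := (hst ▸ hU : D.UniqueBelow (D.weight t.sum)).not_count_lt ht hs hst.symm
      fun x hx => hmax' x hx.symm
    have h3 := (Finset.mem_filter.1 hc).2
    omega

end DecompositionSystem

end UniqueDecomposition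

namespace HOmp

-- Processes modulo bisimilarity as a decomposition system

section Decomposition

variable {S : Type u} {ob : S → Ty S}

/-- Bisimilarity as a setoid. -/
def bisimSetoid (ob : S → Ty S) (T : Ty S) : Setoid (Tm ob T) where
  r := Bisim
  iseqv := ⟨.refl, .symm, .trans⟩

/-- Terms modulo bisimilarity. -/
def BQ (ob : S → Ty S) (T : Ty S) : Type u := Quotient (bisimSetoid ob T)

/-- The class of a term modulo bisimilarity. -/
def Tm.cls {T : Ty S} (P : Tm ob T) : BQ ob T := Quotient.mk _ P

theorem Tm.cls_eq_cls {T : Ty S} {P Q : Tm ob T} : P.cls = Q.cls ↔ Bisim P Q :=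
  ⟨fun h => Quotient.exact h, fun h => Quotient.sound h⟩

theorem BQ.exists_cls {T : Ty S} (x : BQ ob T) : ∃ P : Tm ob T, P.cls = x := Quotient.exists_rep x

instance : Add (BQ ob .proc) :=
  ⟨Quotient.map₂ Tm.par fun _ _ h₁ _ _ h₂ => Bisim.par h₁ h₂⟩

instance : Zero (BQ ob .proc) := ⟨Tm.nil.cls⟩

theorem Tm.cls_par (P Q : Proc ob) : (Tm.par P Q).cls = P.cls + Q.cls := rfl

instance : AddCommMonoid (BQ ob .proc) where
  add_assoc a b c := by
    obtain ⟨P, rfl⟩ := a.exists_cls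
    obtain ⟨Q, rfl⟩ := b.exists_cls
    obtain ⟨R, rfl⟩ := c.exists_cls
    exact Tm.cls_eq_cls.2 (SC.par_assoc P Q R).bisim
  zero_add a := by
    obtain ⟨P, rfl⟩ := a.exists_cls
    exact Tm.cls_eq_cls.2 ((SC.par_comm _ _).trans (SC.par_nil P)).bisim
  add_zero a := by
    obtain ⟨P, rfl⟩ := a.exists_cls
    exact Tm.cls_eq_cls.2 (SC.par_nil P).bisim
  add_comm a b := by
    obtain ⟨P, rfl⟩ := a.exists_cls
    obtain ⟨Q, rfl⟩ := b.exists_cls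
    exact Tm.cls_eq_cls.2 (SC.par_comm P Q).bisim
  nsmul := nsmulRec

/-- The size of a process class. -/
noncomputable def BQ.weight : BQ ob .proc →+ ℕ where
  toFun := Quotient.lift Tm.size fun _ _ h => Bisim.size_eq h
  map_zero' := Tm.size_nil
  map_add' a b := by
    obtain ⟨P, rfl⟩ := a.exists_cls
    obtain ⟨Q, rfl⟩ := b.exists_cls
    exact Tm.size_par P Q

theorem Tm.weight_cls (P : Proc ob) : BQ.weight P.cls = P.size := rfl

/-- Renaming of process classes. -/
noncomputable def BQ.rename (p : Ren (Ty S)) : BQ ob .proc →+ BQ ob .proc where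
  toFun := Quotient.map (fun P => P.rename p Ren.id) fun _ _ h => Bisim.rename h _ _
  map_zero' := rfl
  map_add' a b := by
    obtain ⟨P, rfl⟩ := a.exists_cls
    obtain ⟨Q, rfl⟩ := b.exists_cls
    rfl

theorem Tm.rename_cls (P : Proc ob) (p : Ren (Ty S)) :
    BQ.rename p P.cls = (P.rename p Ren.id).cls := rfl

theorem BQ.weight_rename (p : Ren (Ty S)) (x : BQ ob .proc) :
    BQ.weight (BQ.rename p x) = BQ.weight x := by
  obtain ⟨P, rfl⟩ := x.exists_cls
  rw [Tm.rename_cls, Tm.weight_cls, Tm.weight_cls, Tm.size_rename]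

/-- The inverse lowers positive indices of type `T` by one. Its value at index `0` is irrelevant,
since `Ren.shift` never produces that index. -/
theorem BQ.exists_rename_shift_leftInverse (T : Ty S) :
    ∃ p : Ren (Ty S), ∀ x : BQ ob .proc, BQ.rename p (BQ.rename (Ren.shift T) x) = x := by
  refine ⟨cons (K := fun _ => ℕ) T 0 Ren.id, fun x => ?_⟩
  obtain ⟨P, rfl⟩ := x.exists_cls
  rw [Tm.rename_cls, Tm.rename_cls, Tm.rename_rename]
  simp only [cons_shift]
  exact congrArg Tm.cls P.rename_id

theorem BQ.eq_zero_of_weight (x : BQ ob .proc) (h : BQ.weight x = 0) : x = 0 := by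
  obtain ⟨P, rfl⟩ := x.exists_cls
  exact Tm.cls_eq_cls.2 (Tm.sc_nil_of_size_eq_zero h).bisim

/-- A splitting of the weakened element is pulled back by the left inverse. The latter preserves
weight, so a summand that it sends to `0` was `0` already. -/
theorem BQ.indecomposable_rename_shift (T : Ty S) {x : BQ ob .proc} (hx : Indecomposable x) :
    Indecomposable (BQ.rename (Ren.shift T) x) := by
  obtain ⟨p, hp⟩ := BQ.exists_rename_shift_leftInverse (ob := ob) T
  refine ⟨fun h => hx.1 ?_, fun y z h => ?_⟩
  · rw [← hp x, h, map_zero]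
  · have h0 : ∀ y : BQ ob .proc, BQ.rename p y = 0 → y = 0 := fun y hy =>
      BQ.eq_zero_of_weight y (by rw [← BQ.weight_rename p, hy, map_zero])
    have := hx.2 (BQ.rename p y) (BQ.rename p z) (by rw [← map_add, ← h, hp])
    exact this.imp (h0 y) (h0 z)

/-- The observation that a component gives rise to. -/
def Hd.lab : Hd ob (Tm ob) → Hd ob (BQ ob)
  | .inp m _ => .inp m 0
  | .out m A => .out m A.cls
  | .var i => .var i
  | .papp i A => .papp i A.cls
  | .napp i n => .napp i n

theorem Hd.lab_eq_of_match {h h' : Hd ob (Tm ob)} (hh : h.Match (fun _ A B => Bisim A B) h') :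
    h.lab = h'.lab := by
  cases hh with
  | out m h => simp only [lab, Tm.cls_eq_cls.2 h]
  | papp i h => simp only [lab, Tm.cls_eq_cls.2 h]
  | _ => rfl

/-- What the class of a process becomes when a component in parallel to it acts. -/
noncomputable def Hd.frameHom : Hd ob (BQ ob) → (BQ ob .proc →+ BQ ob .proc)
  | .inp (s := s) _ _ => BQ.rename (Ren.shift (ob s))
  | _ => .id _

theorem Hd.cls_frame (h : Hd ob (Tm ob)) (P : Proc ob) :
    (h.frame P).cls = h.lab.frameHom P.cls := by
  cases h <;> rfl

/-- Observations of process classes. -/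
def BQ.Tr (l : Hd ob (BQ ob)) (x x' : BQ ob .proc) : Prop :=
  ∃ (P : Proc ob) (h : Hd ob (Tm ob)) (P' : Proc ob),
    P.cls = x ∧ SC P (.par h.toTm P') ∧ h.lab = l ∧ (h.cont P').cls = x'

/-- Transitions of a class can be read off any representative, because bisimilar processes answer
each other's observations. -/
theorem BQ.tr_cls_iff {l : Hd ob (BQ ob)} {P : Proc ob} {x : BQ ob .proc} :
    BQ.Tr l P.cls x ↔ ∃ (h : Hd ob (Tm ob)) (P' : Proc ob),
      SC P (.par h.toTm P') ∧ h.lab = l ∧ (h.cont P').cls = x := by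
  constructor
  · rintro ⟨Q, h, Q', hQ, hs, rfl, rfl⟩
    obtain ⟨h', P', hs', hm, hb⟩ := (Tm.cls_eq_cls.1 hQ).hd hs
    exact ⟨h', P', hs', (Hd.lab_eq_of_match hm).symm, Tm.cls_eq_cls.2 hb.symm⟩
  · rintro ⟨h, P', h₁, h₂, h₃⟩
    exact ⟨P, h, P', rfl, h₁, h₂, h₃⟩

theorem Hd.cls_cont_par (h : Hd ob (Tm ob)) {R P Q : Proc ob} (hR : SC R (.par P Q)) :
    (h.cont R).cls = (h.cont P).cls + h.lab.frameHom Q.cls := by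
  rw [← h.cls_frame, ← Tm.cls_par]
  exact Tm.cls_eq_cls.2 ((h.cont_congr hR).trans (h.cont_par P Q)).bisim

variable (ob) in
/-- The processes modulo bisimilarity with their observations. -/
noncomputable def decompositionSystem : DecompositionSystem (BQ ob .proc) (Hd ob (BQ ob)) where
  weight := BQ.weight
  tr := BQ.Tr
  frame := Hd.frameHom
  eq_zero_of_weight := BQ.eq_zero_of_weight
  weight_frame l x := by
    cases l with
    | inp => exact BQ.weight_rename _ x
    | _ => rfl
  frame_injective l := by
    cases l with
    | @inp s =>
      obtain ⟨p, hp⟩ := BQ.exists_rename_shift_leftInverse (ob := ob) (ob s)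
      exact Function.LeftInverse.injective hp
    | _ => exact Function.injective_id
  indecomposable_frame l x hx := by
    cases l with
    | inp => exact BQ.indecomposable_rename_shift _ hx
    | _ => exact hx
  weight_lt := by
    rintro l x x' ⟨P, h, P', rfl, hs, rfl, rfl⟩
    rw [Tm.weight_cls, Tm.weight_cls, hs.size_par_hd]
    exact h.size_cont_lt P'
  exists_tr x hx := by
    obtain ⟨P, rfl⟩ := x.exists_cls
    rcases sc_nil_or_exists_hd P with h0 | ⟨h, P', hs⟩
    · exact absurd (Tm.cls_eq_cls.2 h0.bisim) hx
    · exact ⟨_, _, P, h, P', rfl, hs, rfl, rfl⟩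
  tr_add_left := by
    rintro l x x' y ⟨P, h, P', rfl, hs, rfl, rfl⟩
    obtain ⟨Q, rfl⟩ := y.exists_cls
    refine ⟨.par P Q, h, .par P' Q, rfl, ?_, rfl, h.cls_cont_par (.refl _)⟩
    exact (SC.par hs (.refl _)).trans (.par_assoc _ _ _)
  tr_add := by
    intro l x y z hz
    obtain ⟨P, rfl⟩ := x.exists_cls
    obtain ⟨Q, rfl⟩ := y.exists_cls
    rw [← Tm.cls_par, BQ.tr_cls_iff] at hz
    obtain ⟨h, R, hs, rfl, rfl⟩ := hz
    rcases hs.par_split with ⟨P', hP', hR⟩ | ⟨Q', hQ', hR⟩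
    · exact .inl ⟨_, ⟨P, h, P', rfl, hP', rfl, rfl⟩, h.cls_cont_par hR⟩
    · exact .inr ⟨_, ⟨Q, h, Q', rfl, hQ', rfl, rfl⟩, h.cls_cont_par (hR.trans (.par_comm _ _))⟩

theorem isPrime_iff (P : Proc ob) : IsPrime P ↔ Indecomposable P.cls := by
  constructor
  · rintro ⟨h₁, h₂⟩
    refine ⟨fun h => h₁ (Tm.cls_eq_cls.1 h), fun y z h => ?_⟩
    obtain ⟨Q, rfl⟩ := y.exists_cls
    obtain ⟨R, rfl⟩ := z.exists_cls
    exact (h₂ Q R (Tm.cls_eq_cls.1 h)).imp Tm.cls_eq_cls.2 Tm.cls_eq_cls.2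
  · rintro ⟨h₁, h₂⟩
    refine ⟨fun h => h₁ (Tm.cls_eq_cls.2 h), fun Q R h => ?_⟩
    exact (h₂ Q.cls R.cls (Tm.cls_eq_cls.2 h)).imp Tm.cls_eq_cls.1 Tm.cls_eq_cls.1

theorem cls_parList (L : List (Proc ob)) : (parList L).cls = (L.map Tm.cls).sum := by
  induction L with
  | nil => rfl
  | cons P L ih =>
    cases L with
    | nil => simp [parList]
    | cons Q L => rw [parList, Tm.cls_par, ih, List.map_cons (l := Q :: L), List.sum_cons]

theorem isPrimeDecomposition_iff (P : Proc ob) {n : ℕ} (Ps : Fin n → Proc ob) :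
    IsPrimeDecomposition P Ps ↔ (∀ i, Indecomposable (Ps i).cls) ∧
      P.cls = (Finset.univ.val.map fun i => (Ps i).cls).sum := by
  rw [IsPrimeDecomposition, ← Tm.cls_eq_cls, cls_parList, List.map_ofFn, List.sum_ofFn]
  exact and_congr (forall_congr' fun i => isPrime_iff _) Iff.rfl

/-- Equal multiplicities mean that the fibres of `f` and `g` over each value are equinumerous;
bijections between the fibres are glued together. -/
theorem exists_equiv_of_map_univ_eq {α β γ : Type*} [Fintype α] [Fintype β] {f : α → γ} {g : β → γ}
    (h : (Finset.univ.val.map f : Multiset γ) = Finset.univ.val.map g) :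
    ∃ σ : α ≃ β, ∀ a, f a = g (σ a) := by
  classical
  have hcard : ∀ c, Nonempty ({a // f a = c} ≃ {b // g b = c}) := by
    intro c
    rw [← Fintype.card_eq, Fintype.card_subtype, Fintype.card_subtype]
    have := congrArg (Multiset.count c) h
    simp only [Multiset.count_map, eq_comm (a := c)] at this
    exact this
  exact ⟨Equiv.ofFiberEquiv fun c => (hcard c).some,
    fun a => (Equiv.ofFiberEquiv_map _ a).symm⟩

end Decomposition

end HOmp

theorem mainTheorem8 {S : Type u} (ob : S → HOmp.Ty S) (P : HOmp.Proc ob) :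
    (∃ (n : ℕ) (Ps : Fin n → HOmp.Proc ob), HOmp.IsPrimeDecomposition P Ps) ∧
    ∀ (n m : ℕ) (Ps : Fin n → HOmp.Proc ob) (Qs : Fin m → HOmp.Proc ob),
      HOmp.IsPrimeDecomposition P Ps → HOmp.IsPrimeDecomposition P Qs →
        ∃ (h : n = m) (σ : Equiv.Perm (Fin n)),
          ∀ i : Fin n, HOmp.Bisim (Ps i) (Qs (Fin.cast h (σ i))) := by
  constructor
  · obtain ⟨s, hs, hsum⟩ := (HOmp.decompositionSystem ob).exists_decomposition P.cls
    obtain ⟨L, rfl⟩ := Quot.exists_rep s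
    choose f hf using fun x : HOmp.BQ ob .proc => x.exists_cls
    refine ⟨L.length, fun i => f (L.get i), ?_⟩
    rw [HOmp.isPrimeDecomposition_iff]
    simp only [hf]
    refine ⟨fun i => hs _ (L.get_mem i), hsum.symm.trans ?_⟩
    rw [Fin.univ_val_map, List.ofFn_get]
    rfl
  · intro n m Ps Qs hP hQ
    rw [HOmp.isPrimeDecomposition_iff] at hP hQ
    have key := (HOmp.decompositionSystem ob).unique_decomposition
      (s := Finset.univ.val.map fun i => (Ps i).cls) (t := Finset.univ.val.map fun i => (Qs i).cls)
      (by simpa using hP.1) (by simpa using hQ.1) (hP.2.symm.trans hQ.2)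
    have hnm : n = m := by simpa using congrArg Multiset.card key
    subst hnm
    obtain ⟨σ, hσ⟩ := HOmp.exists_equiv_of_map_univ_eq key
    exact ⟨rfl, σ, fun i => HOmp.Tm.cls_eq_cls.1 (hσ i)⟩
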